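/- Let $q\ge 1$ be an integer and let $G=(V,E)$ be a $(q+1)$-regular undirected graph, possibly infinite, in which multiple edges and multiple loops are allowed. Each undirected edge (loops included) corresponds to two distinct directed edges $e,\overline e$, inverse to each other; the degree of a vertex is the number of directed edges starting at it. Let $A$ be the adjacency operator on $\ell^2(V)$, $(Af)(v)=\sum_{e:\,o(e)=v}f(t(e))$, where $o(e)$ and $t(e)$ are the origin and the terminus of $e$. For $v\in V$ let $\mu_G^v$ be the spectral measure of $q^{-1/2}A$ at $\mathbf 1_v$, i.e. the unique probability measure on $\mathbb R$ with finite moments such that $\int P\,d\mu_G^v=\langle \mathbf 1_v,P(q^{-1/2}A)\mathbf 1_v\rangle$ for all $P\in\mathbb R[x]$. Let $\mu_q$ (the Kesten–McKay distribution) be this measure for the $(q+1)$-regular tree at any of its vertices. For $r\ge1$ let $f_r(v;G)$ be the number of closed walks $(e_0,\dots,e_{r-1})$ of length $r$ from $v$ to $v$ with $e_i\ne\overline{e_{i+1}}$ for $0\le i\le r-2$. Define polynomials $X_{r,q}$ by $$\frac{1-q^{-1}t^2}{1-xt+t^2}=\sum_{r\ge0}X_{r,q}(x)\,t^r .$$ For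 $\rho>1$ let $$\Omega(\rho)=\Big\{w\in\mathbb C:\frac{(\mathrm{Re}\,w)^2}{(\rho+\rho^{-1})^2}+\frac{(\mathrm{Im}\,w)^2}{(\rho-\rho^{-1})^2}<1\Big\}.$$ **Theorem 5.1 (discrete pre-trace formula).** Let $\rho>q^{1/2}$ and let $h$ be holomorphic on $\Omega(\rho)$. For every $v\in V$, $$\int_{\mathbb R}h\,d\mu_G^v=\int_{\mathbb R}h\,d\mu_q+\sum_{r=1}^{\infty}q^{-r/2}\,a_{r,q}(h)\,f_r(v;G),\qquad a_{r,q}(h)=(1+q^{-1})^{-1}\int_{-2}^{2}h(x)X_{r,q}(x)\,d\mu_q(x),$$ where all the integrals exist and the series converges absolutely. -/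

import Mathlib

open scoped ENNReal

noncomputable section

/-! ## Spectral measures -/

section Spectral

variable {H : Type*} [NormedAddCommGroup H] [InnerProductSpace ℂ H] [CompleteSpace H]

/-- `μ` is a probability measure on `ℝ` all of whose moments exist, and
`∫ P dμ = ⟨φ, P(A) φ⟩` for every real polynomial `P`. -/
structure IsSpectralMeasure (A : H →L[ℂ] H) (φ : H) (μ : MeasureTheory.Measure ℝ) : Prop where
  isProbabilityMeasure : MeasureTheory.IsProbabilityMeasure μ
  integrable : ∀ P : Polynomial ℝ, MeasureTheory.Integrable (fun x : ℝ => P.eval x) μ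
  integral_eq : ∀ P : Polynomial ℝ,
    ((∫ x, P.eval x ∂μ : ℝ) : ℂ) = inner ℂ φ (Polynomial.aeval A P φ)

theorem exists_isSpectralMeasure (A : H →L[ℂ] H) (hA : IsSelfAdjoint A) (φ : H) (hφ : ‖φ‖ = 1) :
    ∃ μ : MeasureTheory.Measure ℝ, IsSpectralMeasure A φ μ := by
  classical
  let S := spectrum ℝ A
  let Φ : C(S, ℝ) →⋆ₐ[ℝ] (H →L[ℂ] H) := cfcHom hA
  have hsa : ∀ f : C(S, ℝ), ContinuousLinearMap.adjoint (Φ f) = Φ f := fun f => by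
    have h : star (Φ f) = Φ f := by rw [← map_star]; congr 1
    exact h
  have hre : ∀ f : C(S, ℝ), (((inner ℂ φ (Φ f φ)).re : ℝ) : ℂ) = inner ℂ φ (Φ f φ) := fun f => by
    apply Complex.conj_eq_iff_re.mp
    rw [inner_conj_symm]
    conv_rhs => rw [← hsa f, ContinuousLinearMap.adjoint_inner_right]
  let L : C(S, ℝ) →ₗ[ℝ] ℝ :=
    { toFun := fun f => (inner ℂ φ (Φ f φ)).re
      map_add' := fun f g => by simp
      map_smul' := fun c f => by
        rw [map_smul, smul_apply, inner_smul_right_eq_smul]; simp }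
  have hpos : ∀ f : C(S, ℝ), 0 ≤ f → 0 ≤ L f := fun f hf => by
    let g : C(S, ℝ) := ⟨fun x => Real.sqrt (f x), by fun_prop⟩
    have hfg : f = g * g := by ext x; exact (Real.mul_self_sqrt (hf x)).symm
    have : inner ℂ φ (Φ f φ) = inner ℂ (Φ g φ) (Φ g φ) := by
      rw [hfg, map_mul, mul_apply_eq_comp, ← ContinuousLinearMap.adjoint_inner_left,
        hsa]
    change 0 ≤ (inner ℂ φ (Φ f φ)).re
    rw [this]
    exact inner_self_nonneg (𝕜 := ℂ)
  have : CompactSpace S := isCompact_iff_compactSpace.mp (spectrum.isCompact (𝕜 := ℝ) A)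
  let Λ : CompactlySupportedContinuousMap S ℝ →ₚ[ℝ] ℝ := PositiveLinearMap.mk₀
    { toFun := fun f => L (CompactlySupportedContinuousMap.continuousMapEquiv.symm f)
      map_add' := fun f g => by rw [← map_add]; rfl
      map_smul' := fun c f => by rw [← map_smul]; rfl }
    (fun f hf => hpos _ hf)
  let ν := RealRMK.rieszMeasure Λ
  have hν : ∀ f : C(S, ℝ), ∫ x, f x ∂ν = L f := fun f =>
    RealRMK.integral_rieszMeasure Λ (CompactlySupportedContinuousMap.continuousMapEquiv f)
  have hν1 : ν.real Set.univ = 1 := by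
    have h := hν 1
    have h1 : L 1 = 1 := by
      change (inner ℂ φ (Φ 1 φ)).re = 1
      rw [map_one, one_apply_eq_self, inner_self_eq_norm_sq_to_K, hφ]; simp
    simpa [h1] using h
  have hνp : MeasureTheory.IsProbabilityMeasure ν := by
    constructor
    rw [MeasureTheory.measureReal_def] at hν1
    exact (ENNReal.toReal_eq_one_iff _).mp hν1
  have hm : Measurable (Subtype.val : S → ℝ) := measurable_subtype_coe
  refine ⟨ν.map Subtype.val, MeasureTheory.Measure.isProbabilityMeasure_map hm.aemeasurable,
    fun P => ?_, fun P => ?_⟩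
  · rw [MeasureTheory.integrable_map_measure (by fun_prop) hm.aemeasurable]
    exact (Continuous.integrable_of_hasCompactSupport (by fun_prop)
      (HasCompactSupport.of_compactSpace _))
  · rw [MeasureTheory.integral_map hm.aemeasurable (by fun_prop)]
    have h := hν (P.toContinuousMapOn S)
    have hP : Φ (P.toContinuousMapOn S) = Polynomial.aeval A P := by
      have : (Φ : C(S, ℝ) →ₐ[ℝ] (H →L[ℂ] H)).comp (Polynomial.toContinuousMapOnAlgHom S)
          = Polynomial.aeval A := by
        ext1
        simp only [AlgHom.comp_apply, Polynomial.toContinuousMapOnAlgHom_apply,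
          Polynomial.toContinuousMapOn_X_eq_restrict_id, Polynomial.aeval_X]
        exact cfcHom_id hA
      exact DFunLike.congr_fun this P
    have h' : ∫ x : S, P.eval (x : ℝ) ∂ν = (inner ℂ φ (Φ (P.toContinuousMapOn S) φ)).re := h
    rw [h', hre, hP]

/-- The spectral measure at the unit vector `φ` of a bounded self-adjoint operator `A`
on a Hilbert space. -/
def spectralMeasure (A : H →L[ℂ] H) (hA : IsSelfAdjoint A) (φ : H) (hφ : ‖φ‖ = 1) :
    MeasureTheory.Measure ℝ :=
  (exists_isSpectralMeasure A hA φ hφ).choose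

theorem isSpectralMeasure_spectralMeasure (A : H →L[ℂ] H) (hA : IsSelfAdjoint A) (φ : H)
    (hφ : ‖φ‖ = 1) : IsSpectralMeasure A φ (spectralMeasure A hA φ hφ) :=
  (exists_isSpectralMeasure A hA φ hφ).choose_spec

end Spectral

/-! ## Graphs, possibly infinite, with multiple edges and multiple loops -/

/-- An undirected graph with vertex set `V`, given by its set `E` of directed edges: every
undirected edge, loops included, corresponds to exactly two directed edges, which are exchanged
by the inversion `inv`. -/
structure Multigraph (V E : Type*) where
  /-- origin of a directed edge -/
  o : E → V
  /-- terminus of a directed edge -/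
  t : E → V
  /-- the inverse directed edge -/
  inv : E → E
  inv_inv : ∀ e, inv (inv e) = e
  inv_ne : ∀ e, inv e ≠ e
  o_inv : ∀ e, o (inv e) = t e

namespace Multigraph

variable {V E : Type*} (G : Multigraph V E)

theorem t_inv (e : E) : G.t (G.inv e) = G.o e := by rw [← G.o_inv, G.inv_inv]

/-- Every vertex has degree `d`: exactly `d` directed edges start at it
(so that a loop counts twice). -/
def IsRegular (d : ℕ) : Prop :=
  ∀ v, Finite {e : E // G.o e = v} ∧ Nat.card {e : E // G.o e = v} = d

/-- A walk of length `n`, with vertices `p 0, …, p n` and directed edges `e 0, …, e (n - 1)`. -/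
def IsWalk {n : ℕ} (p : Fin (n + 1) → V) (e : Fin n → E) : Prop :=
  ∀ i : Fin n, p i.castSucc = G.o (e i) ∧ p i.succ = G.t (e i)

/-- No directed edge of the sequence is the inverse of the next one. -/
def IsNonBacktracking {n : ℕ} (e : Fin n → E) : Prop :=
  ∀ i j : Fin n, (j : ℕ) = i + 1 → e i ≠ G.inv (e j)

/-- `f_r(v; G)`, the number of closed non-backtracking walks of length `r` from `v` to `v`. -/
def closedNBWalkCount (r : ℕ) (v : V) : ℕ :=
  Nat.card {γ : (Fin (r + 1) → V) × (Fin r → E) //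
    G.IsWalk γ.1 γ.2 ∧ G.IsNonBacktracking γ.2 ∧ γ.1 0 = v ∧ γ.1 (Fin.last r) = v}

/-- The adjacency operator on functions: `(A f)(v)` is the sum of `f (t e)` over the directed
edges `e` with origin `v`. -/
def adjFun (f : V → ℂ) (v : V) : ℂ := ∑' e : {e : E // G.o e = v}, f (G.t e)

section Adjacency

variable {G} {d : ℕ}

theorem IsRegular.hasSum_sq_o (hG : G.IsRegular d) (f : lp (fun _ : V => ℂ) 2) :
    HasSum (fun e : E => ‖f (G.o e)‖ ^ 2) ((d : ℝ) * ‖f‖ ^ 2) := by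
  have hf : HasSum (fun v : V => ‖f v‖ ^ 2) (‖f‖ ^ 2) := by
    simpa using lp.hasSum_norm (p := 2) (by norm_num) f
  have hcard : ∀ v, HasSum (fun _ : {e : E // G.o e = v} => ‖f v‖ ^ 2)
      ((d : ℝ) * ‖f v‖ ^ 2) := fun v => by
    have := (hG v).1
    let _ := Fintype.ofFinite {e : E // G.o e = v}
    have h := hasSum_fintype (fun _ : {e : E // G.o e = v} => ‖f v‖ ^ 2)
    have hc := (hG v).2
    rw [Nat.card_eq_fintype_card] at hc
    simpa [hc] using h
  rw [← (Equiv.sigmaFiberEquiv G.o).hasSum_iff]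
  have hs : Summable (fun x : (Σ v, {e : E // G.o e = v}) => ‖f x.1‖ ^ 2) := by
    rw [summable_sigma_of_nonneg (fun x => by positivity)]
    refine ⟨fun v => (hcard v).summable, ?_⟩
    simp_rw [(hcard _).tsum_eq]
    exact hf.summable.mul_left _
  have he : ((fun e : E => ‖f (G.o e)‖ ^ 2) ∘ (Equiv.sigmaFiberEquiv G.o)) =
      fun x : (Σ v, {e : E // G.o e = v}) => ‖f x.1‖ ^ 2 := by
    funext ⟨v, e, h⟩
    simp [Equiv.sigmaFiberEquiv, h]
  rw [he, ← (hs.hasSum.sigma hcard).unique (hf.mul_left _)]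
  exact hs.hasSum

/-- Inversion as a permutation of the directed edges. -/
def invEquiv (G : Multigraph V E) : E ≃ E := ⟨G.inv, G.inv, G.inv_inv, G.inv_inv⟩

theorem IsRegular.hasSum_sq_t (hG : G.IsRegular d) (f : lp (fun _ : V => ℂ) 2) :
    HasSum (fun e : E => ‖f (G.t e)‖ ^ 2) ((d : ℝ) * ‖f‖ ^ 2) := by
  have h := (G.invEquiv.hasSum_iff).mpr (hG.hasSum_sq_o f)
  have he : ((fun e : E => ‖f (G.o e)‖ ^ 2) ∘ G.invEquiv) = fun e : E => ‖f (G.t e)‖ ^ 2 := by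
    funext e; simp [invEquiv, G.o_inv]
  rwa [he] at h

theorem IsRegular.adjFun_bound (hG : G.IsRegular d) (f : lp (fun _ : V => ℂ) 2) :
    Summable (fun v => ‖G.adjFun f v‖ ^ 2) ∧
      ∑' v, ‖G.adjFun f v‖ ^ 2 ≤ ((d : ℝ) * ‖f‖) ^ 2 := by
  have h := ((Equiv.sigmaFiberEquiv G.o).hasSum_iff).mpr (hG.hasSum_sq_t f)
  have hin : ∀ v, HasSum (fun e : {e : E // G.o e = v} => ‖f (G.t e)‖ ^ 2)
      (∑' e : {e : E // G.o e = v}, ‖f (G.t e)‖ ^ 2) := fun v => by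
    have := (hG v).1
    exact (Summable.of_finite).hasSum
  have h2 := (h.sigma hin).mul_left (d : ℝ)
  have hle : ∀ v, ‖G.adjFun f v‖ ^ 2 ≤ d * ∑' e : {e : E // G.o e = v}, ‖f (G.t e)‖ ^ 2 := by
    intro v
    have := (hG v).1
    let _ := Fintype.ofFinite {e : E // G.o e = v}
    have hc := (hG v).2
    rw [Nat.card_eq_fintype_card, ← Finset.card_univ] at hc
    simp only [adjFun, tsum_fintype]
    calc ‖∑ e : {e : E // G.o e = v}, f (G.t e)‖ ^ 2
        ≤ (∑ e : {e : E // G.o e = v}, ‖f (G.t e)‖) ^ 2 := by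
          gcongr; exact norm_sum_le _ _
      _ ≤ _ := by
          have := sq_sum_le_card_mul_sum_sq (s := (Finset.univ : Finset {e : E // G.o e = v}))
            (f := fun e => ‖f (G.t e)‖)
          rwa [hc] at this
  have hsum := Summable.of_nonneg_of_le (fun v => by positivity) hle h2.summable
  refine ⟨hsum, (hsum.tsum_le_tsum hle h2.summable).trans (le_of_eq ?_)⟩
  rw [h2.tsum_eq]; ring

/-- The adjacency operator of a regular graph, as a bounded operator on `ℓ²(V)`. -/
def adjacency (G : Multigraph V E) (hG : G.IsRegular d) :
    lp (fun _ : V => ℂ) 2 →L[ℂ] lp (fun _ : V => ℂ) 2 :=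
  LinearMap.mkContinuous
    { toFun := fun f => ⟨G.adjFun f, memℓp_gen (by simpa using (hG.adjFun_bound f).1)⟩
      map_add' := fun f g => by
        ext v
        have := (hG v).1
        simp only [adjFun, lp.coeFn_add, Pi.add_apply]
        exact Summable.tsum_add Summable.of_finite Summable.of_finite
      map_smul' := fun c f => by
        ext v
        simp only [adjFun, lp.coeFn_smul, Pi.smul_apply, smul_eq_mul, RingHom.id_apply]
        exact tsum_mul_left }
    d (fun f => lp.norm_le_of_tsum_le (by norm_num) (by positivity)
      (by simpa using (hG.adjFun_bound f).2))

@[simp] theorem adjacency_apply (hG : G.IsRegular d) (f : lp (fun _ : V => ℂ) 2) (v : V) :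
    G.adjacency hG f v = ∑' e : {e : E // G.o e = v}, f (G.t e) := rfl

theorem IsRegular.hasSum_inner (hG : G.IsRegular d) (f g : lp (fun _ : V => ℂ) 2) :
    HasSum (fun e : E => inner ℂ (f (G.o e)) (g (G.t e))) (inner ℂ f (G.adjacency hG g)) := by
  have hs : Summable (fun e : E => inner ℂ (f (G.o e)) (g (G.t e))) := by
    refine Summable.of_norm_bounded ((hG.hasSum_sq_o f).summable.add
      (hG.hasSum_sq_t g).summable) (fun e => (norm_inner_le_norm _ _).trans ?_)
    nlinarith [sq_nonneg (‖f (G.o e)‖ - ‖g (G.t e)‖), sq_nonneg (‖f (G.o e)‖ + ‖g (G.t e)‖)]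
  have h := ((Equiv.sigmaFiberEquiv G.o).hasSum_iff).mpr hs.hasSum
  have hin : ∀ v, HasSum (fun e : {e : E // G.o e = v} => inner ℂ (f (G.o e)) (g (G.t e)))
      (inner ℂ (f v) (G.adjacency hG g v)) := fun v => by
    have := (hG v).1
    let _ := Fintype.ofFinite {e : E // G.o e = v}
    rw [adjacency_apply, tsum_fintype, inner_sum]
    have he : (fun e : {e : E // G.o e = v} => inner ℂ (f (G.o e)) (g (G.t e))) =
        fun e : {e : E // G.o e = v} => inner ℂ (f v) (g (G.t e)) := by
      funext e; rw [e.2]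
    rw [he]
    exact hasSum_fintype _
  rw [(lp.hasSum_inner f (G.adjacency hG g)).unique (h.sigma hin)]
  exact hs.hasSum

theorem isSelfAdjoint_adjacency (hG : G.IsRegular d) : IsSelfAdjoint (G.adjacency hG) := by
  rw [ContinuousLinearMap.isSelfAdjoint_iff_isSymmetric]
  intro f g
  have h1 := (G.invEquiv.hasSum_iff).mpr (hG.hasSum_inner f g)
  have h2 := (Complex.hasSum_conj'.mpr (hG.hasSum_inner g f))
  rw [inner_conj_symm] at h2
  refine h2.unique ?_
  have he : (fun e : E => (starRingEnd ℂ) (inner ℂ (g (G.o e)) (f (G.t e)))) =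
      (fun e => inner ℂ (f (G.o e)) (g (G.t e))) ∘ G.invEquiv := by
    funext e
    simp only [invEquiv, Function.comp_apply, Equiv.coe_fn_mk, G.o_inv, G.t_inv]
    exact inner_conj_symm _ _
  rw [he]
  exact h1

end Adjacency

/-- The indicator function of the vertex `v`, as an element of `ℓ²(V)`. -/
def indicator (v : V) : lp (fun _ : V => ℂ) 2 :=
  open Classical in lp.single 2 v (1 : ℂ)

theorem norm_indicator (v : V) : ‖indicator v‖ = 1 := by
  classical
  simp [indicator, lp.norm_single]

/-- The normalized adjacency operator `q^(-1/2) A` of a `(q + 1)`-regular graph. -/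
def normalizedAdjacency {q : ℕ} (hG : G.IsRegular (q + 1)) :
    lp (fun _ : V => ℂ) 2 →L[ℂ] lp (fun _ : V => ℂ) 2 :=
  (((q : ℝ) ^ (-(1 / 2) : ℝ) : ℝ) : ℂ) • G.adjacency hG

theorem isSelfAdjoint_normalizedAdjacency {q : ℕ} (hG : G.IsRegular (q + 1)) :
    IsSelfAdjoint (G.normalizedAdjacency hG) :=
  IsSelfAdjoint.smul (Complex.conj_ofReal _) (isSelfAdjoint_adjacency hG)

/-- The normalized spectral measure `μ_G^v` of a `(q + 1)`-regular graph `G` at the vertex `v`. -/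
def vertexSpectralMeasure {q : ℕ} (hG : G.IsRegular (q + 1)) (v : V) :
    MeasureTheory.Measure ℝ :=
  spectralMeasure (G.normalizedAdjacency hG) (G.isSelfAdjoint_normalizedAdjacency hG)
    (indicator v) (norm_indicator v)

end Multigraph

/-! ## The regular tree and the Kesten-McKay distribution -/

/-- Words in the letters `0, …, q` in which no two consecutive letters agree. -/
def ReducedWord (q : ℕ) : Type := {l : List (Fin (q + 1)) // l.IsChain (· ≠ ·)}

namespace ReducedWord

variable {q : ℕ}

/-- The empty word. -/
def nil : ReducedWord q := ⟨[], List.isChain_nil⟩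

/-- Prepend the letter `a`, and cancel if the word already starts with `a`. -/
def step (a : Fin (q + 1)) : ReducedWord q → ReducedWord q
  | ⟨[], _⟩ => ⟨[a], List.isChain_singleton a⟩
  | ⟨b :: l, h⟩ => if hab : a = b then ⟨l, h.tail⟩ else ⟨a :: b :: l, h.cons_cons hab⟩

theorem step_step (a : Fin (q + 1)) (w : ReducedWord q) : step a (step a w) = w := by
  obtain ⟨l, h⟩ := w
  match l, h with
  | [], h => simp [step]; rfl
  | b :: l, h =>
    by_cases hab : a = b
    · subst hab
      match l, h with
      | [], h => simp [step]; rfl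
      | c :: l, h =>
        have hac : a ≠ c := (List.isChain_cons_cons.mp h).1
        simp [step, hac]; rfl
    · simp [step, hab]; rfl

theorem step_ne (a : Fin (q + 1)) (w : ReducedWord q) : step a w ≠ w := by
  obtain ⟨l, h⟩ := w
  intro he
  have hlen := congrArg (fun w : ReducedWord q => w.1.length) he
  match l, h with
  | [], h => simp [step] at hlen
  | b :: l, h =>
    by_cases hab : a = b
    · simp [step, hab] at hlen
    · simp [step, hab] at hlen

end ReducedWord

/-- The `(q + 1)`-regular tree: the vertices are the reduced words, and the directed edges from
`w` are labelled by the letters `a`, leading to the word obtained from `w` by prepending `a` or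
by deleting an initial `a`. It is a tree, with the empty word as a root, because every nonempty
word `a :: l` has exactly one neighbour that is shorter, its tail `l`. -/
def regularTree (q : ℕ) : Multigraph (ReducedWord q) (ReducedWord q × Fin (q + 1)) where
  o e := e.1
  t e := ReducedWord.step e.2 e.1
  inv e := (ReducedWord.step e.2 e.1, e.2)
  inv_inv e := by simp [ReducedWord.step_step]
  inv_ne e h := ReducedWord.step_ne e.2 e.1 (congrArg Prod.fst h)
  o_inv _ := rfl

theorem isRegular_regularTree (q : ℕ) : (regularTree q).IsRegular (q + 1) := by
  intro w
  let φ : {e : ReducedWord q × Fin (q + 1) // (regularTree q).o e = w} ≃ Fin (q + 1) :=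
    { toFun := fun e => e.1.2
      invFun := fun a => ⟨(w, a), rfl⟩
      left_inv := by rintro ⟨⟨w', a⟩, rfl⟩; rfl
      right_inv := fun _ => rfl }
  exact ⟨Finite.of_equiv _ φ.symm, by rw [Nat.card_congr φ, Nat.card_fin]⟩

/-- The Kesten-McKay distribution `μ_q`: the normalized spectral measure of the
`(q + 1)`-regular tree at its root. -/
def kestenMcKay (q : ℕ) : MeasureTheory.Measure ℝ :=
  (regularTree q).vertexSpectralMeasure (isRegular_regularTree q) ReducedWord.nil

/-! ## Chebyshev-type polynomials, elliptic domains and coefficients -/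

/-- The polynomial `X_{r,q}`: the coefficient of `t^r` in the expansion of
`(1 - q⁻¹ t²) / (1 - x t + t²)` as a power series in `t` over `ℝ[x]`. -/
def chebX (r q : ℕ) : Polynomial ℝ :=
  PowerSeries.coeff r
    ((1 - PowerSeries.C (Polynomial.C (q : ℝ)⁻¹) * PowerSeries.X ^ 2) *
      PowerSeries.invOfUnit
        (1 - PowerSeries.C (Polynomial.X : Polynomial ℝ) * PowerSeries.X + PowerSeries.X ^ 2) 1)

/-- The interior `Ω(ρ)` of the ellipse with semi-axes `ρ + ρ⁻¹` and `|ρ - ρ⁻¹|`. -/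
def ellipseInterior (ρ : ℝ) : Set ℂ :=
  {w : ℂ | w.re ^ 2 / (ρ + ρ⁻¹) ^ 2 + w.im ^ 2 / (ρ - ρ⁻¹) ^ 2 < 1}

/-- The coefficient `a_{r,q}(h)` of `h` along `X_{r,q}`: the integral of `h X_{r,q}` over `[-2,2]`
against `μ_q`, divided by `1 + q⁻¹`, the squared norm of `X_{r,q}` in `L²(μ_q)` for `r ≥ 1`. -/
def chebCoeff (r q : ℕ) (h : ℂ → ℂ) : ℂ :=
  (1 + (q : ℂ)⁻¹)⁻¹ *
    ∫ x in Set.Icc (-2 : ℝ) 2, h (x : ℂ) * (((chebX r q).eval x : ℝ) : ℂ) ∂(kestenMcKay q)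

end

/-!
The polynomials `X_{r,q}` satisfy `x X_r = X_{r+1} + X_{r-1}` for `r ≥ 2`, with the correction
`x X_1 = X_2 + (1 + q⁻¹) X_0` at the start. The operators `q^(-r/2) A_r`, where `A_r` counts
non-backtracking walks of length `r`, satisfy the same recurrence in `q^(-1/2) A`, hence
`X_{r,q}(q^(-1/2) A) = q^(-r/2) A_r` and `∫ X_{r,q} dμ_G^v = q^(-r/2) f_r(v; G)` for `r ≥ 1`
(`Multigraph.integral_chebX_vertexSpectralMeasure`).

The tree has no closed non-backtracking walks of positive length, so `∫ X_{r,q} dμ_q = 0` for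
`r ≥ 1`, and the recurrence alone then gives the orthogonality relations
`∫ X_{r,q} X_{s,q} dμ_q = (1 + q⁻¹) δ_{rs}` for `r ≥ 1` (`integral_chebX_mul_chebX_kestenMcKay`).
By Fatou's lemma these also show that `μ_q` lives on `[-2, 2]`, because `X_{r,q}(x)²` tends to
infinity for `|x| > 2`. In the same way the bound `‖q^(-1/2) A‖ ≤ √q + 1/√q` puts `μ_G^v` on the
interval `I = [-√q - 1/√q, √q + 1/√q]`.

The analytic step is the expansion `h = ∑ b_r X_{r,q}`, absolute and uniform on `I`
(`exists_chebX_expansion`). With `w = t + t⁻¹`, the Cauchy kernel `dw / (w - x)` is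
`-(1 - t²) / (t (1 - x t + t²)) dt`, which is the generating function of the `X_{r,q}(x)` up to a
factor independent of `x`. The Cauchy formula over the ellipse `|t| = s` with
`1/ρ < s < 1/√q` gives `b_r = O(s^r)`, while `|X_{r,q}| ≤ 2 (r + 1) q^(r/2)` on `I`.

Integrating the expansion against `μ_q` yields `b_0`, integrating `h X_{r,q}` against `μ_q` shows
`b_r = a_{r,q}(h)` for `r ≥ 1`, and integrating against `μ_G^v` gives the pre-trace formula.
-/

/-! ### Counting non-backtracking walks -/

namespace Multigraph

variable {V E : Type*} (G : Multigraph V E)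

theorem eq_inv_comm {e e' : E} : e = G.inv e' ↔ e' = G.inv e :=
  ⟨fun h => by rw [h, G.inv_inv], fun h => by rw [h, G.inv_inv]⟩

/-- Non-backtracking walks of length `n + 1` with first edge `e` and terminus `w`, given by their
sequences of directed edges. -/
def NBPath (n : ℕ) (e : E) (w : V) : Type _ :=
  {γ : Fin (n + 1) → E // γ 0 = e ∧
    (∀ i : Fin n, G.o (γ i.succ) = G.t (γ i.castSucc) ∧ γ i.succ ≠ G.inv (γ i.castSucc)) ∧
    G.t (γ (Fin.last n)) = w}

/-- Splitting off the first edge of a non-backtracking walk. -/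
def nbPathSuccEquiv (n : ℕ) (e : E) (w : V) :
    G.NBPath (n + 1) e w ≃
      Σ e' : {e' : E // G.o e' = G.t e ∧ e' ≠ G.inv e}, G.NBPath n e' w where
  toFun γ := ⟨⟨γ.1 1, by
      obtain ⟨γ, h0, h1, h2⟩ := γ
      have := h1 0
      simpa [h0] using this⟩,
    ⟨Fin.tail γ.1, rfl, fun i => γ.2.2.1 i.succ, γ.2.2.2⟩⟩
  invFun x := ⟨Fin.cons e x.2.1, by
    obtain ⟨⟨e', h1, h2⟩, γ, h0, h3, h4⟩ := x
    refine ⟨rfl, fun i => ?_, ?_⟩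
    · refine Fin.cases ?_ (fun j => ?_) i
      · simpa [h0] using ⟨h1, h2⟩
      · simpa [← Fin.succ_castSucc] using h3 j
    · rw [← Fin.succ_last, Fin.cons_succ]
      exact h4⟩
  left_inv := by
    rintro ⟨γ, rfl, h1, h2⟩
    exact Subtype.ext (Fin.cons_self_tail γ)
  right_inv := by
    rintro ⟨⟨e', h1, h2⟩, γ, h0, h3, h4⟩
    have h0' : γ 0 = e' := h0
    subst h0'
    rfl

/-- The number of non-backtracking walks of length `n + 1` with first edge `e` and terminus `w`. -/
noncomputable def nbPathCount (n : ℕ) (e : E) (w : V) : ℕ := Nat.card (G.NBPath n e w)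

theorem nbPathCount_zero (e : E) (w : V) [Decidable (G.t e = w)] :
    G.nbPathCount 0 e w = if G.t e = w then 1 else 0 := by
  unfold nbPathCount NBPath
  split_ifs with h
  · rw [Nat.card_eq_one_iff_unique]
    refine ⟨⟨fun a b => Subtype.ext (funext fun i => ?_)⟩,
      ⟨⟨fun _ => e, rfl, fun i => i.elim0, h⟩⟩⟩
    rw [Subsingleton.elim (α := Fin 1) i 0, a.2.1, b.2.1]
  · have : IsEmpty {γ : Fin (0 + 1) → E // γ 0 = e ∧
        (∀ i : Fin 0, G.o (γ i.succ) = G.t (γ i.castSucc) ∧ γ i.succ ≠ G.inv (γ i.castSucc)) ∧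
        G.t (γ (Fin.last 0)) = w} := by
      refine ⟨fun γ => h ?_⟩
      rw [← γ.2.1]
      exact γ.2.2.2
    exact Nat.card_of_isEmpty

/-- A closed non-backtracking walk of positive length is determined by its edges. -/
def closedNBWalkEquiv (n : ℕ) (v w : V) :
    {γ : (Fin (n + 1 + 1) → V) × (Fin (n + 1) → E) //
      G.IsWalk γ.1 γ.2 ∧ G.IsNonBacktracking γ.2 ∧ γ.1 0 = v ∧ γ.1 (Fin.last (n + 1)) = w} ≃
      Σ e : {e : E // G.o e = v}, G.NBPath n e w where
  toFun γ := ⟨⟨γ.1.2 0, by rw [← (γ.2.1 0).1]; exact γ.2.2.2.1⟩,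
    ⟨γ.1.2, rfl, fun i => ⟨by
      rw [← (γ.2.1 i.succ).1, ← (γ.2.1 i.castSucc).2, Fin.succ_castSucc], fun h =>
        γ.2.2.1 i.castSucc i.succ (by simp) (G.eq_inv_comm.mp h)⟩, by
      rw [← (γ.2.1 (Fin.last n)).2, Fin.succ_last]; exact γ.2.2.2.2⟩⟩
  invFun x := ⟨(Fin.cons v (fun i => G.t (x.2.1 i)), x.2.1), by
    obtain ⟨⟨e, h1⟩, γ, h0, h3, h4⟩ := x
    refine ⟨fun i => ⟨?_, rfl⟩, fun i j hij h => ?_, rfl, ?_⟩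
    · refine Fin.cases ?_ (fun j => ?_) i
      · have h0' : γ 0 = e := h0
        simp [h0', h1]
      · rw [← Fin.succ_castSucc]
        exact (h3 j).1.symm
    · have hi : (i : ℕ) < n := by omega
      have hi' : i = (⟨i, hi⟩ : Fin n).castSucc := rfl
      have hj' : j = (⟨i, hi⟩ : Fin n).succ := Fin.ext hij
      rw [hi', hj'] at h
      exact (h3 _).2 (G.eq_inv_comm.mp h)
    · rw [← Fin.succ_last]
      exact h4⟩
  left_inv := by
    rintro ⟨⟨p, γ⟩, h1, h2, h3, h4⟩
    refine Subtype.ext (Prod.ext (funext fun i => ?_) rfl)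
    refine Fin.cases ?_ (fun j => ?_) i
    · exact h3.symm
    · exact (h1 j).2.symm
  right_inv := by
    rintro ⟨⟨e', h1⟩, γ, h0, h3, h4⟩
    have h0' : γ 0 = e' := h0
    subst h0'
    rfl

variable {G} {d : ℕ}

/-- The finite set of directed edges with origin `v`. -/
noncomputable def IsRegular.outEdges (hG : G.IsRegular d) (v : V) : Finset E :=
  (show {e : E | G.o e = v}.Finite from (hG v).1).toFinset

theorem IsRegular.mem_outEdges (hG : G.IsRegular d) {v : V} {e : E} :
    e ∈ hG.outEdges v ↔ G.o e = v := by
  simp [outEdges]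

theorem IsRegular.card_outEdges (hG : G.IsRegular d) (v : V) : (hG.outEdges v).card = d := by
  refine Eq.trans ?_ (hG v).2
  rw [← Nat.card_eq_finsetCard]
  exact Nat.card_congr (Equiv.subtypeEquivRight fun e => hG.mem_outEdges)

theorem IsRegular.adjacency_eq_sum (hG : G.IsRegular d) (f : lp (fun _ : V => ℂ) 2) (v : V) :
    G.adjacency hG f v = ∑ e ∈ hG.outEdges v, f (G.t e) := by
  rw [adjacency_apply, ← Finset.tsum_subtype]
  exact (Equiv.subtypeEquivRight fun e => hG.mem_outEdges.symm).tsum_eq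
    (fun e : {e : E // e ∈ hG.outEdges v} => f (G.t e))

theorem IsRegular.finite_nbPath (hG : G.IsRegular d) (n : ℕ) (e : E) (w : V) :
    Finite (G.NBPath n e w) := by
  induction n generalizing e with
  | zero =>
    have : Subsingleton (G.NBPath 0 e w) := ⟨fun a b => Subtype.ext (funext fun i => by
      rw [Subsingleton.elim (α := Fin 1) i 0, a.2.1, b.2.1])⟩
    infer_instance
  | succ n ih =>
    have := ih
    have : Finite {e' : E // G.o e' = G.t e} := (hG (G.t e)).1
    have : Finite {e' : E // G.o e' = G.t e ∧ e' ≠ G.inv e} :=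
      Finite.of_injective (Subtype.map id fun _ h => h.1 : _ → {e' : E // G.o e' = G.t e})
        (Subtype.map_injective _ Function.injective_id)
    exact Finite.of_equiv _ (G.nbPathSuccEquiv n e w).symm

theorem IsRegular.nbPathCount_succ [DecidableEq E] (hG : G.IsRegular d) (n : ℕ) (e : E) (w : V) :
    G.nbPathCount (n + 1) e w =
      ∑ e' ∈ (hG.outEdges (G.t e)).erase (G.inv e), G.nbPathCount n e' w := by
  have := fun e => hG.finite_nbPath n e w
  have hp : ∀ e' : E, G.o e' = G.t e ∧ e' ≠ G.inv e ↔
      e' ∈ (hG.outEdges (G.t e)).erase (G.inv e) := fun e' => by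
    rw [Finset.mem_erase, hG.mem_outEdges, and_comm]
  rw [nbPathCount, Nat.card_congr ((G.nbPathSuccEquiv n e w).trans
    (Equiv.sigmaCongrLeft' (Equiv.subtypeEquivRight hp))), Nat.card_sigma]
  exact Finset.sum_coe_sort _ fun e' => G.nbPathCount n e' w

theorem IsRegular.closedNBWalkCount_succ (hG : G.IsRegular d) (n : ℕ) (v : V) :
    G.closedNBWalkCount (n + 1) v = ∑ e ∈ hG.outEdges v, G.nbPathCount n e v := by
  have := fun e => hG.finite_nbPath n e v
  rw [closedNBWalkCount, Nat.card_congr ((G.closedNBWalkEquiv n v v).trans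
    (Equiv.sigmaCongrLeft' (Equiv.subtypeEquivRight fun e => hG.mem_outEdges.symm))),
    Nat.card_sigma]
  exact Finset.sum_coe_sort _ fun e => G.nbPathCount n e v

/-- The recurrence `A A₁ = A₂ + d` for the operators `Aᵣ` counting non-backtracking walks. -/
theorem IsRegular.sum_nbPathCount_zero [DecidableEq V] (hG : G.IsRegular d) (v w : V) :
    ∑ e ∈ hG.outEdges v, ∑ e' ∈ hG.outEdges (G.t e), (G.nbPathCount 0 e' w : ℂ) =
      ∑ e ∈ hG.outEdges v, (G.nbPathCount 1 e w : ℂ) + d * (if v = w then 1 else 0) := by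
  classical
  have h : ∀ e ∈ hG.outEdges v, ∑ e' ∈ hG.outEdges (G.t e), (G.nbPathCount 0 e' w : ℂ) =
      G.nbPathCount 1 e w + if v = w then 1 else 0 := fun e he => by
    rw [hG.nbPathCount_succ, Nat.cast_sum,
      ← Finset.sum_erase_add _ _ (hG.mem_outEdges.mpr (G.o_inv e)), G.nbPathCount_zero (G.inv e),
      G.t_inv, hG.mem_outEdges.mp he]
    simp
  rw [Finset.sum_congr rfl h, Finset.sum_add_distrib, Finset.sum_const, hG.card_outEdges,
    nsmul_eq_mul]

/-- The recurrence `A Aᵣ = Aᵣ₊₁ + q Aᵣ₋₁`, for `r ≥ 2`, for the operators `Aᵣ` counting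
non-backtracking walks. -/
theorem IsRegular.sum_nbPathCount_succ {q : ℕ} (hG : G.IsRegular (q + 1)) (n : ℕ) (v w : V) :
    ∑ e ∈ hG.outEdges v, ∑ e' ∈ hG.outEdges (G.t e), (G.nbPathCount (n + 1) e' w : ℂ) =
      ∑ e ∈ hG.outEdges v, (G.nbPathCount (n + 2) e w : ℂ) +
        q * ∑ e ∈ hG.outEdges v, (G.nbPathCount n e w : ℂ) := by
  classical
  -- Separate the walks that start by going back along `e`: deleting `inv e` from such a walk
  -- leaves a walk that starts at `v` with any edge other than `e`.
  have h : ∀ e ∈ hG.outEdges v, ∑ e' ∈ hG.outEdges (G.t e), (G.nbPathCount (n + 1) e' w : ℂ) =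
      G.nbPathCount (n + 2) e w +
        (∑ e' ∈ hG.outEdges v, (G.nbPathCount n e' w : ℂ) - G.nbPathCount n e w) :=
    fun e he => by
    rw [hG.nbPathCount_succ (n + 1) e, Nat.cast_sum,
      ← Finset.sum_erase_add _ _ (hG.mem_outEdges.mpr (G.o_inv e)),
      hG.nbPathCount_succ n (G.inv e), G.t_inv, G.inv_inv, hG.mem_outEdges.mp he, Nat.cast_sum,
      ← Finset.sum_erase_eq_sub he]
  rw [Finset.sum_congr rfl h, Finset.sum_add_distrib, Finset.sum_sub_distrib, Finset.sum_const,
    hG.card_outEdges, nsmul_eq_mul]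
  push_cast
  ring

end Multigraph

/-! ### The polynomials `X_{r,q}` -/

section ChebX

open Polynomial

/-- The defining power series of the `X_{r,q}`, with the denominator cleared. -/
theorem coeff_mul_mk_chebX (q n : ℕ) :
    PowerSeries.coeff n ((1 - PowerSeries.C (X : ℝ[X]) * PowerSeries.X + PowerSeries.X ^ 2) *
      PowerSeries.mk fun r => chebX r q) =
    PowerSeries.coeff n
      (1 - PowerSeries.C (C (q : ℝ)⁻¹) * PowerSeries.X ^ 2 : PowerSeries ℝ[X]) := by
  have h : (PowerSeries.mk fun r => chebX r q) =
      (1 - PowerSeries.C (C (q : ℝ)⁻¹) * PowerSeries.X ^ 2) *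
      PowerSeries.invOfUnit
        (1 - PowerSeries.C (X : ℝ[X]) * PowerSeries.X + PowerSeries.X ^ 2) 1 := by
    ext1 n
    rw [PowerSeries.coeff_mk]
    rfl
  rw [h, mul_left_comm, PowerSeries.mul_invOfUnit _ _ (by simp), mul_one]

theorem chebX_zero (q : ℕ) : chebX 0 q = 1 := by
  have h := coeff_mul_mk_chebX q 0
  simpa [add_mul, sub_mul, mul_assoc, PowerSeries.coeff_X_pow] using h

theorem chebX_one (q : ℕ) : chebX 1 q = X := by
  have h := coeff_mul_mk_chebX q 1
  simp only [add_mul, sub_mul, one_mul, mul_assoc, map_add, map_sub, PowerSeries.coeff_C_mul,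
    PowerSeries.coeff_succ_X_mul, PowerSeries.coeff_mk, pow_two, PowerSeries.coeff_zero_X_mul,
    PowerSeries.coeff_one, PowerSeries.coeff_zero_X, chebX_zero] at h
  simp only [one_ne_zero, if_false] at h
  linear_combination h

theorem chebX_two (q : ℕ) : chebX 2 q = X * chebX 1 q - C (1 + (q : ℝ)⁻¹) := by
  have h := coeff_mul_mk_chebX q 2
  simp only [add_mul, sub_mul, one_mul, mul_assoc, map_add, map_sub, PowerSeries.coeff_C_mul,
    PowerSeries.coeff_succ_X_mul, PowerSeries.coeff_mk, pow_two,
    PowerSeries.coeff_one, PowerSeries.coeff_one_X, chebX_zero] at h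
  norm_num at h
  simp only [C_add, C_1]
  linear_combination h

theorem chebX_add_three (n q : ℕ) :
    chebX (n + 3) q = X * chebX (n + 2) q - chebX (n + 1) q := by
  have h := coeff_mul_mk_chebX q (n + 3)
  simp only [add_mul, sub_mul, one_mul, mul_assoc, map_add, map_sub, PowerSeries.coeff_C_mul,
    PowerSeries.coeff_succ_X_mul, PowerSeries.coeff_mk, pow_two,
    PowerSeries.coeff_one, PowerSeries.coeff_X] at h
  rw [if_neg (by omega), if_neg (by omega), zero_sub, neg_eq_zero.mpr (mul_zero _)] at h
  linear_combination h

theorem natDegree_chebX_le (r q : ℕ) : (chebX r q).natDegree ≤ r := by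
  induction r using Nat.strong_induction_on with
  | _ r ih =>
    match r with
    | 0 => simp [chebX_zero]
    | 1 => simp [chebX_one]
    | 2 =>
      rw [chebX_two]
      refine (natDegree_sub_le _ _).trans (max_le ?_ (by simp))
      exact natDegree_mul_le.trans (by have := ih 1 (by omega); simp; omega)
    | n + 3 =>
      rw [chebX_add_three]
      refine (natDegree_sub_le _ _).trans (max_le ?_ ?_)
      · exact natDegree_mul_le.trans (by have := ih (n + 2) (by omega); simp; omega)
      · exact (ih (n + 1) (by omega)).trans (by omega)

theorem chebX_eval_neg (r q : ℕ) (x : ℝ) :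
    (chebX r q).eval (-x) = (-1) ^ r * (chebX r q).eval x := by
  induction r using Nat.strong_induction_on with
  | _ r ih =>
    match r with
    | 0 => simp [chebX_zero]
    | 1 => simp [chebX_one]
    | 2 => simp [chebX_two, chebX_one]
    | n + 3 =>
      simp only [chebX_add_three, eval_sub, eval_mul, eval_X, ih (n + 2) (by omega),
        ih (n + 1) (by omega)]
      ring

theorem tendsto_chebX_eval_atTop (q : ℕ) {x : ℝ} (hx : 2 < x) :
    Filter.Tendsto (fun n : ℕ => (chebX (n + 1) q).eval x) Filter.atTop Filter.atTop := by
  have hq : (q : ℝ)⁻¹ ≤ 1 := Nat.cast_inv_le_one q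
  -- `D` is a lower bound of `X_2 - X_1`, and the differences increase.
  set D := x ^ 2 - x - 2
  have hD : 0 < D := by simp only [D]; nlinarith
  have key : ∀ n : ℕ, 2 + n * D ≤ (chebX (n + 1) q).eval x ∧
      D ≤ (chebX (n + 2) q).eval x - (chebX (n + 1) q).eval x := by
    intro n
    induction n with
    | zero =>
      simp only [D, chebX_one, chebX_two, eval_sub, eval_mul, eval_X, eval_C, zero_add]
      constructor
      · push_cast; linarith
      · nlinarith
    | succ n ih =>
      obtain ⟨h1, h2⟩ := ih
      have h3 : 0 ≤ n * D := by positivity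
      refine ⟨by push_cast; linarith, ?_⟩
      rw [chebX_add_three]
      simp only [eval_sub, eval_mul, eval_X]
      nlinarith
  refine Filter.tendsto_atTop_mono (fun n => (key n).1) ?_
  exact Filter.tendsto_atTop_add_const_left _ _
    (tendsto_natCast_atTop_atTop.atTop_mul_const hD)

theorem tendsto_sq_chebX_eval_atTop (q : ℕ) {x : ℝ} (hx : 2 < |x|) :
    Filter.Tendsto (fun n : ℕ => (chebX (n + 1) q).eval x * (chebX (n + 1) q).eval x)
      Filter.atTop Filter.atTop := by
  have h := tendsto_chebX_eval_atTop q hx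
  refine (h.atTop_mul_atTop₀ h).congr fun n => ?_
  rcases abs_choice x with h | h
  · rw [h]
  · rw [h, chebX_eval_neg, mul_mul_mul_comm, ← mul_pow]
    simp

/-! ### Orthogonality -/

theorem map_X_pow_mul_chebX {q : ℕ} {L : ℝ[X] →ₗ[ℝ] ℝ} (hL : ∀ n, L (chebX (n + 1) q) = 0)
    {k r : ℕ} (h : k < r) : L (X ^ k * chebX r q) = 0 := by
  induction k generalizing r with
  | zero =>
    obtain ⟨n, rfl⟩ := Nat.exists_eq_add_of_lt h
    simpa using hL n
  | succ k ih =>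
    obtain ⟨n, rfl⟩ : ∃ n, r = n + 2 := ⟨r - 2, by omega⟩
    have e : X ^ (k + 1) * chebX (n + 2) q =
        X ^ k * chebX (n + 3) q + X ^ k * chebX (n + 1) q := by
      rw [chebX_add_three]; ring
    rw [e, map_add, ih (by omega), ih (by omega), add_zero]

theorem map_mul_chebX_of_natDegree_lt {q : ℕ} {L : ℝ[X] →ₗ[ℝ] ℝ}
    (hL : ∀ n, L (chebX (n + 1) q) = 0) {P : ℝ[X]} {r : ℕ} (h : P.natDegree < r) :
    L (P * chebX r q) = 0 := by
  rw [P.as_sum_range_C_mul_X_pow, Finset.sum_mul, map_sum]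
  refine Finset.sum_eq_zero fun k hk => ?_
  rw [mul_assoc, ← smul_eq_C_mul, map_smul,
    map_X_pow_mul_chebX hL ((Finset.mem_range_succ_iff.mp hk).trans_lt h), smul_zero]

/-- A linear functional which takes the value `1` at `1` and vanishes at all `X_{r,q}`, `r ≥ 1`,
makes the `X_{r,q}` orthogonal, by the three-term recurrence. -/
theorem map_chebX_mul_chebX {q : ℕ} {L : ℝ[X] →ₗ[ℝ] ℝ} (h1 : L 1 = 1)
    (hL : ∀ n, L (chebX (n + 1) q) = 0) (n s : ℕ) :
    L (chebX s q * chebX (n + 1) q) = if s = n + 1 then 1 + (q : ℝ)⁻¹ else 0 := by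
  split_ifs with hs
  · subst hs
    induction n with
    | zero =>
      have e : chebX 1 q * chebX 1 q = chebX 2 q + (1 + (q : ℝ)⁻¹) • 1 := by
        rw [chebX_two, chebX_one, smul_eq_C_mul]; ring
      rw [zero_add, e, map_add, map_smul, hL, h1]
      simp
    | succ n ih =>
      have e : ∃ R : ℝ[X], R.natDegree < n + 2 ∧ chebX (n + 2) q = X * chebX (n + 1) q - R := by
        cases n with
        | zero => exact ⟨_, by simp, chebX_two q⟩
        | succ n => exact ⟨_, (natDegree_chebX_le _ _).trans_lt (by omega), chebX_add_three n q⟩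
      obtain ⟨R, hR, e⟩ := e
      have e' : chebX (n + 2) q * chebX (n + 2) q = chebX (n + 1) q * chebX (n + 3) q +
          chebX (n + 1) q * chebX (n + 1) q - R * chebX (n + 2) q := by
        rw [chebX_add_three]
        linear_combination chebX (n + 2) q * e
      rw [e', map_sub, map_add, map_mul_chebX_of_natDegree_lt hL hR, ih,
        map_mul_chebX_of_natDegree_lt hL ((natDegree_chebX_le _ _).trans_lt (by omega))]
      ring
  · rcases lt_or_gt_of_ne hs with h | h
    · exact map_mul_chebX_of_natDegree_lt hL ((natDegree_chebX_le _ _).trans_lt h)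
    · obtain ⟨m, rfl⟩ : ∃ m, s = m + 1 := ⟨s - 1, by omega⟩
      rw [mul_comm]
      exact map_mul_chebX_of_natDegree_lt hL ((natDegree_chebX_le _ _).trans_lt h)

end ChebX

/-! ### Supports of spectral measures -/

section Support

open MeasureTheory Filter

/-- If the integrals of nonnegative functions `f n` are bounded, then almost nowhere does `f n`
tend to infinity, by Fatou's lemma. -/
theorem ae_not_tendsto_atTop_of_integral_le {α : Type*} [MeasurableSpace α] {μ : Measure α}
    {f : ℕ → α → ℝ} {C : ℝ} (hm : ∀ n, Measurable (f n)) (h0 : ∀ n x, 0 ≤ f n x)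
    (hi : ∀ n, Integrable (f n) μ) (hC : ∀ n, ∫ x, f n x ∂μ ≤ C) :
    ∀ᵐ x ∂μ, ¬ Tendsto (fun n => f n x) atTop atTop := by
  have hle : ∫⁻ x, liminf (fun n => ENNReal.ofReal (f n x)) atTop ∂μ ≤ ENNReal.ofReal C := by
    refine (lintegral_liminf_le fun n => (hm n).ennreal_ofReal).trans ?_
    refine liminf_le_of_le (by isBoundedDefault) fun b hb => ?_
    obtain ⟨n, hn⟩ := hb.exists
    refine hn.trans ?_
    rw [← ofReal_integral_eq_lintegral_ofReal (hi n) (ae_of_all _ (h0 n))]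
    exact ENNReal.ofReal_le_ofReal (hC n)
  filter_upwards [ae_lt_top (.liminf fun n => (hm n).ennreal_ofReal)
    (hle.trans_lt ENNReal.ofReal_lt_top).ne] with x hx ht
  exact hx.ne (ENNReal.tendsto_ofReal_nhds_top.mpr ht).liminf_eq

/-- A spectral measure of `A` is concentrated on `[-M, M]` if `‖A‖ ≤ M`: the even moments are at
most `M ^ (2 n)`. -/
theorem IsSpectralMeasure.ae_abs_le {H : Type*} [NormedAddCommGroup H] [InnerProductSpace ℂ H]
    [CompleteSpace H] {A : H →L[ℂ] H} {φ : H} {μ : Measure ℝ} (hμ : IsSpectralMeasure A φ μ)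
    (hφ : ‖φ‖ = 1) {M : ℝ} (hM : 0 < M) (hA : ‖A‖ ≤ M) : ∀ᵐ x ∂μ, |x| ≤ M := by
  have hmom : ∀ n : ℕ, ∫ x, ((x / M) ^ 2) ^ n ∂μ ≤ 1 := fun n => by
    have h := hμ.integral_eq (Polynomial.X ^ (2 * n))
    simp only [Polynomial.eval_pow, Polynomial.eval_X, map_pow, Polynomial.aeval_X] at h
    have hb : ‖((∫ x, x ^ (2 * n) ∂μ : ℝ) : ℂ)‖ ≤ M ^ (2 * n) := by
      rw [h]
      refine (norm_inner_le_norm _ _).trans ?_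
      rw [hφ, one_mul]
      refine ((A ^ (2 * n)).le_opNorm φ).trans ?_
      rw [hφ, mul_one]
      have : Nontrivial H := ⟨φ, 0, fun h => by simp [h] at hφ⟩
      exact (norm_pow_le A _).trans (pow_le_pow_left₀ (norm_nonneg _) hA _)
    rw [Complex.norm_real] at hb
    have e : ∀ x : ℝ, ((x / M) ^ 2) ^ n = x ^ (2 * n) * (M ^ (2 * n))⁻¹ := fun x => by
      rw [← pow_mul, div_pow, div_eq_mul_inv]
    simp_rw [e]
    rw [integral_mul_const, ← div_eq_mul_inv, div_le_one (by positivity)]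
    exact (le_abs_self _).trans hb
  have hint : ∀ n : ℕ, Integrable (fun x : ℝ => ((x / M) ^ 2) ^ n) μ := fun n => by
    have h := hμ.integrable (((Polynomial.C M⁻¹ * Polynomial.X) ^ 2) ^ n)
    simpa [div_eq_inv_mul] using h
  filter_upwards [ae_not_tendsto_atTop_of_integral_le (fun n => by fun_prop)
    (fun n x => by positivity) hint hmom] with x hx
  by_contra! hlt
  refine hx (tendsto_pow_atTop_atTop_of_one_lt ?_)
  rw [← sq_abs, abs_div, abs_of_pos hM]
  exact one_lt_pow₀ ((one_lt_div hM).mpr hlt) two_ne_zero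

/-- Integration of polynomials against a spectral measure. -/
noncomputable def IsSpectralMeasure.integralₗ {H : Type*} [NormedAddCommGroup H]
    [InnerProductSpace ℂ H] [CompleteSpace H] {A : H →L[ℂ] H} {φ : H} {μ : Measure ℝ}
    (hμ : IsSpectralMeasure A φ μ) : Polynomial ℝ →ₗ[ℝ] ℝ where
  toFun P := ∫ x, P.eval x ∂μ
  map_add' P Q := by
    simp only [Polynomial.eval_add]
    exact integral_add (hμ.integrable P) (hμ.integrable Q)
  map_smul' c P := by
    simp only [Polynomial.eval_smul, RingHom.id_apply]
    exact integral_smul c _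

end Support

/-! ### Spectral measures of regular graphs -/

namespace Multigraph

open MeasureTheory

variable {V E : Type*} {G : Multigraph V E} {q : ℕ}

theorem isSpectralMeasure_vertexSpectralMeasure (hG : G.IsRegular (q + 1)) (v : V) :
    IsSpectralMeasure (G.normalizedAdjacency hG) (indicator v) (G.vertexSpectralMeasure hG v) :=
  isSpectralMeasure_spectralMeasure _ _ _ _

open Classical in
theorem indicator_apply (v w : V) : indicator w v = if v = w then 1 else 0 := by
  rw [indicator, lp.coeFn_single, Pi.single_apply]

theorem inner_indicator (v : V) (f : lp (fun _ : V => ℂ) 2) :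
    inner ℂ (indicator v) f = f v := by
  classical
  rw [indicator, lp.inner_single_left]
  simp

theorem rpow_neg_half_sq_mul (hq : 1 ≤ q) :
    (((q : ℝ) ^ (-(1 / 2) : ℝ) : ℝ) : ℂ) ^ 2 * q = 1 := by
  have h : ((q : ℝ) ^ (-(1 / 2) : ℝ)) ^ 2 * q = 1 := by
    have hq' : (0 : ℝ) < q := by exact_mod_cast hq
    rw [← Real.rpow_natCast, ← Real.rpow_mul hq'.le]
    norm_num
    rw [Real.rpow_neg_one, inv_mul_cancel₀ hq'.ne']
  exact_mod_cast h

theorem normalizedAdjacency_apply (hG : G.IsRegular (q + 1)) (f : lp (fun _ : V => ℂ) 2) (v : V) :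
    G.normalizedAdjacency hG f v =
      (((q : ℝ) ^ (-(1 / 2) : ℝ) : ℝ) : ℂ) * ∑ e ∈ hG.outEdges v, f (G.t e) := by
  rw [← hG.adjacency_eq_sum]
  rfl

/-- The matrix entries of `X_{r,q}(q^(-1/2) A)` are the numbers of non-backtracking walks of
length `r`, times `q^(-r/2)`. -/
theorem aeval_chebX_indicator_apply (hq : 1 ≤ q) (hG : G.IsRegular (q + 1)) (n : ℕ) (v w : V) :
    Polynomial.aeval (G.normalizedAdjacency hG) (chebX (n + 1) q) (indicator w) v =
      (((q : ℝ) ^ (-(1 / 2) : ℝ) : ℝ) : ℂ) ^ (n + 1) *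
        ∑ e ∈ hG.outEdges v, (G.nbPathCount n e w : ℂ) := by
  classical
  have hc := rpow_neg_half_sq_mul hq
  generalize hcdef : (((q : ℝ) ^ (-(1 / 2) : ℝ) : ℝ) : ℂ) = c at hc
  have hB : ∀ f v, G.normalizedAdjacency hG f v = c * ∑ e ∈ hG.outEdges v, f (G.t e) :=
    fun f v => by rw [normalizedAdjacency_apply, hcdef]
  have h1 : ∀ v, Polynomial.aeval (G.normalizedAdjacency hG) (chebX 1 q) (indicator w) v =
      c ^ 1 * ∑ e ∈ hG.outEdges v, (G.nbPathCount 0 e w : ℂ) := fun v => by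
    rw [chebX_one, Polynomial.aeval_X, hB, pow_one]
    simp [indicator_apply, nbPathCount_zero]
  induction n using Nat.strong_induction_on generalizing v with
  | _ n ih =>
    match n with
    | 0 => exact h1 v
    | 1 =>
      rw [chebX_two]
      simp only [map_sub, map_mul, Polynomial.aeval_X, Polynomial.aeval_C, sub_apply,
        mul_apply_eq_comp, lp.coeFn_sub, Pi.sub_apply, hB, h1,
        ← Finset.mul_sum, hG.sum_nbPathCount_zero]
      have e : (algebraMap ℝ (lp (fun _ : V => ℂ) 2 →L[ℂ] lp (fun _ : V => ℂ) 2)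
          (1 + (q : ℝ)⁻¹)) (indicator w) v = (1 + (q : ℂ)⁻¹) * if v = w then 1 else 0 := by
        rw [Algebra.algebraMap_eq_smul_one, smul_apply, lp.coeFn_smul, Pi.smul_apply,
          one_apply_eq_self, indicator_apply, Complex.real_smul]
        push_cast
        rfl
      rw [e]
      have hi : (q : ℂ)⁻¹ = c ^ 2 := (eq_inv_of_mul_eq_one_left hc).symm
      rw [hi]
      push_cast
      linear_combination (if v = w then (1 : ℂ) else 0) * hc
    | n + 2 =>
      rw [chebX_add_three]
      simp only [map_sub, map_mul, Polynomial.aeval_X, sub_apply,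
        mul_apply_eq_comp, lp.coeFn_sub, Pi.sub_apply, hB,
        ih (n + 1) (by omega), ih n (by omega), ← Finset.mul_sum, hG.sum_nbPathCount_succ]
      linear_combination c ^ (n + 1) * (∑ e ∈ hG.outEdges v, (G.nbPathCount n e w : ℂ)) * hc

theorem integral_chebX_vertexSpectralMeasure (hq : 1 ≤ q) (hG : G.IsRegular (q + 1)) (v : V)
    (n : ℕ) :
    ((∫ x, (chebX (n + 1) q).eval x ∂(G.vertexSpectralMeasure hG v) : ℝ) : ℂ) =
      (((q : ℝ) ^ (-(1 / 2) : ℝ) : ℝ) : ℂ) ^ (n + 1) * (G.closedNBWalkCount (n + 1) v : ℂ) := by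
  rw [(isSpectralMeasure_vertexSpectralMeasure hG v).integral_eq, hG.closedNBWalkCount_succ,
    Nat.cast_sum]
  exact (inner_indicator v _).trans (aeval_chebX_indicator_apply hq hG n v v)

theorem norm_normalizedAdjacency_le (hq : 1 ≤ q) (hG : G.IsRegular (q + 1)) :
    ‖G.normalizedAdjacency hG‖ ≤ √q + (√q)⁻¹ := by
  have hs : 0 < √(q : ℝ) := Real.sqrt_pos.mpr (by exact_mod_cast hq)
  have hA : ‖G.adjacency hG‖ ≤ ((q + 1 : ℕ) : ℝ) :=
    LinearMap.mkContinuous_norm_le _ (Nat.cast_nonneg _) _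
  have hc : (q : ℝ) ^ (-(1 / 2) : ℝ) = (√q)⁻¹ := by
    rw [Real.rpow_neg (Nat.cast_nonneg _), Real.sqrt_eq_rpow]
  rw [normalizedAdjacency, norm_smul, Complex.norm_real, hc, Real.norm_of_nonneg (by positivity)]
  refine (mul_le_mul_of_nonneg_left hA (by positivity)).trans (le_of_eq ?_)
  push_cast
  field_simp
  rw [Real.sq_sqrt (Nat.cast_nonneg _)]

theorem ae_vertexSpectralMeasure_abs_le (hq : 1 ≤ q) (hG : G.IsRegular (q + 1)) (v : V) :
    ∀ᵐ x ∂(G.vertexSpectralMeasure hG v), |x| ≤ √q + (√q)⁻¹ := by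
  have hs : 0 < √(q : ℝ) := Real.sqrt_pos.mpr (by exact_mod_cast hq)
  exact (isSpectralMeasure_vertexSpectralMeasure hG v).ae_abs_le (norm_indicator v)
    (by positivity) (norm_normalizedAdjacency_le hq hG)

end Multigraph

/-! ### The Kesten-McKay distribution -/

/-- A letter that differs from the first one is prepended without cancellation. -/
theorem ReducedWord.step_of_ne {q : ℕ} {a b : Fin (q + 1)} {w : ReducedWord q}
    {l : List (Fin (q + 1))} (hw : w.1 = b :: l) (hab : a ≠ b) :
    (ReducedWord.step a w).1 = a :: w.1 := by
  obtain ⟨w, h⟩ := w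
  change w = b :: l at hw
  subst hw
  simp [step, hab]

/-- In the tree, a non-backtracking walk which starts by moving away from the root never reaches
the root. -/
theorem nbPathCount_regularTree_eq_zero {q : ℕ} (n : ℕ) (e : ReducedWord q × Fin (q + 1))
    (he : (ReducedWord.step e.2 e.1).1 = e.2 :: e.1.1) :
    (regularTree q).nbPathCount n e ReducedWord.nil = 0 := by
  classical
  induction n generalizing e with
  | zero =>
    rw [Multigraph.nbPathCount_zero, if_neg]
    intro h
    have h' : ReducedWord.step e.2 e.1 = ReducedWord.nil := h
    rw [h'] at he
    exact List.noConfusion rfl (heq_of_eq he)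
  | succ n ih =>
    rw [(isRegular_regularTree q).nbPathCount_succ]
    refine Finset.sum_eq_zero fun e' he' => ih e' ?_
    rw [Finset.mem_erase, (isRegular_regularTree q).mem_outEdges] at he'
    obtain ⟨hne, ho⟩ := he'
    have ho' : e'.1 = ReducedWord.step e.2 e.1 := ho
    refine ReducedWord.step_of_ne (b := e.2) (l := e.1.1) (by rw [ho', he])
      fun h => hne (Prod.ext ho' h)

theorem closedNBWalkCount_regularTree (q n : ℕ) :
    (regularTree q).closedNBWalkCount (n + 1) ReducedWord.nil = 0 := by
  rw [(isRegular_regularTree q).closedNBWalkCount_succ]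
  refine Finset.sum_eq_zero fun e he => nbPathCount_regularTree_eq_zero n e ?_
  have h : e.1 = ReducedWord.nil := (isRegular_regularTree q).mem_outEdges.mp he
  rw [h]
  rfl

theorem isSpectralMeasure_kestenMcKay (q : ℕ) :
    IsSpectralMeasure ((regularTree q).normalizedAdjacency (isRegular_regularTree q))
      (Multigraph.indicator ReducedWord.nil) (kestenMcKay q) :=
  Multigraph.isSpectralMeasure_vertexSpectralMeasure _ _

theorem integral_chebX_kestenMcKay {q : ℕ} (hq : 1 ≤ q) (n : ℕ) :
    ∫ x, (chebX (n + 1) q).eval x ∂(kestenMcKay q) = 0 := by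
  have h := Multigraph.integral_chebX_vertexSpectralMeasure hq (isRegular_regularTree q)
    ReducedWord.nil n
  rw [closedNBWalkCount_regularTree, Nat.cast_zero, mul_zero] at h
  exact_mod_cast h

theorem integral_chebX_mul_chebX_kestenMcKay {q : ℕ} (hq : 1 ≤ q) (n s : ℕ) :
    ∫ x, (chebX s q).eval x * (chebX (n + 1) q).eval x ∂(kestenMcKay q) =
      if s = n + 1 then 1 + (q : ℝ)⁻¹ else 0 := by
  have hμ := isSpectralMeasure_kestenMcKay q
  have := hμ.isProbabilityMeasure
  have h := map_chebX_mul_chebX (L := hμ.integralₗ)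
    (by simp [IsSpectralMeasure.integralₗ]) (integral_chebX_kestenMcKay hq) n s
  simpa [IsSpectralMeasure.integralₗ] using h

/-- The Kesten-McKay distribution is concentrated on `[-2, 2]`, since the `X_{r,q}` are bounded in
`L²`, but tend to infinity outside this interval. -/
theorem ae_kestenMcKay_mem_Icc {q : ℕ} (hq : 1 ≤ q) :
    ∀ᵐ x ∂(kestenMcKay q), x ∈ Set.Icc (-2 : ℝ) 2 := by
  filter_upwards [ae_not_tendsto_atTop_of_integral_le
    (f := fun n x => (chebX (n + 1) q).eval x * (chebX (n + 1) q).eval x)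
    (C := 1 + (q : ℝ)⁻¹) (fun n => by fun_prop) (fun n x => mul_self_nonneg _)
    (fun n => by
      simpa using (isSpectralMeasure_kestenMcKay q).integrable
        (chebX (n + 1) q * chebX (n + 1) q))
    (fun n => by rw [integral_chebX_mul_chebX_kestenMcKay hq, if_pos rfl])] with x hx
  rw [Set.mem_Icc, ← abs_le]
  by_contra! h
  exact hx (tendsto_sq_chebX_eval_atTop q h)

/-! ### Bounds and the generating function of the `X_{r,q}` -/

/-- A non-real root `u` of `u + u⁻¹ = x`, with `x` real, lies on the unit circle; a real one is
bounded because `a + a⁻¹` is increasing for `a ≥ 1`. -/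
theorem norm_le_of_sq_sub_mul_add_one_eq_zero {m x : ℝ} (hm : 1 ≤ m) (hx : |x| ≤ m + m⁻¹) {u : ℂ}
    (hu : u ^ 2 - x * u + 1 = 0) : ‖u‖ ≤ m := by
  have hre := congrArg Complex.re hu
  have him := congrArg Complex.im hu
  simp [pow_two] at hre him
  have h0 : u.im * (2 * u.re - x) = 0 := by linarith
  rcases mul_eq_zero.mp h0 with h | h
  · have hn : ‖u‖ = |u.re| := (Complex.abs_re_eq_norm.mpr h).symm
    rw [hn]
    by_contra! hlt
    rw [h] at hre
    have ha : 0 < |u.re| := by linarith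
    have e : |x| * |u.re| = |u.re| ^ 2 + 1 := by
      rw [← abs_mul, sq_abs, abs_of_nonneg (by nlinarith)]
      linarith
    have e2 : |x| * |u.re| ≤ (m + m⁻¹) * |u.re| := mul_le_mul_of_nonneg_right hx ha.le
    have e3 : m⁻¹ ≤ 1 := inv_le_one_of_one_le₀ hm
    have e4 : m * m⁻¹ = 1 := mul_inv_cancel₀ (by linarith)
    have e5 : 0 < (|u.re| - m) * (|u.re| - m⁻¹) := mul_pos (by linarith) (by linarith)
    nlinarith
  · refine le_trans (le_of_eq ?_) hm
    have hx2 : x = 2 * u.re := by linarith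
    rw [hx2] at hre
    rw [Complex.norm_def, Complex.normSq_apply, Real.sqrt_eq_one]
    linarith

theorem norm_sum_pow_mul_pow_le {u v : ℂ} {m : ℝ} (hm : 0 ≤ m) (hu : ‖u‖ ≤ m) (hv : ‖v‖ ≤ m)
    (n : ℕ) : ‖∑ i ∈ Finset.range (n + 1), u ^ i * v ^ (n - i)‖ ≤ (n + 1) * m ^ n := by
  refine (norm_sum_le_of_le (f := fun i => u ^ i * v ^ (n - i)) (n := fun _ => m ^ n) _
    fun i hi => ?_).trans (by simp)
  have hi' : i ≤ n := Finset.mem_range_succ_iff.mp hi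
  rw [norm_mul, norm_pow, norm_pow]
  calc ‖u‖ ^ i * ‖v‖ ^ (n - i) ≤ m ^ i * m ^ (n - i) := by gcongr
    _ = m ^ n := by rw [← pow_add, Nat.add_sub_cancel' hi']

/-- With `x = u + u⁻¹`, the polynomial `X_{r,q}(x)` is the difference of two sums of powers of `u`
and `u⁻¹`, which are at most `m` in absolute value. -/
theorem abs_chebX_eval_le (q : ℕ) {m x : ℝ} (hm : 1 ≤ m) (hx : |x| ≤ m + m⁻¹) (r : ℕ) :
    |(chebX r q).eval x| ≤ 2 * (r + 1) * m ^ r := by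
  obtain ⟨z, hz⟩ := IsAlgClosed.exists_pow_nat_eq ((x : ℂ) ^ 2 - 4) (n := 2) (by norm_num)
  set u : ℂ := (x + z) / 2 with hu
  set v : ℂ := (x - z) / 2 with hv
  have huv : u * v = 1 := by rw [hu, hv]; linear_combination (-1 / 4 : ℂ) * hz
  have hadd : u + v = x := by rw [hu, hv]; ring
  have hum : ‖u‖ ≤ m := norm_le_of_sq_sub_mul_add_one_eq_zero hm hx (by
    rw [← hadd]; linear_combination -huv)
  have hvm : ‖v‖ ≤ m := norm_le_of_sq_sub_mul_add_one_eq_zero hm hx (by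
    rw [← hadd]; linear_combination -huv)
  -- `S n` is the Chebyshev polynomial of the second kind `U_n(x / 2)`.
  set S : ℕ → ℂ := fun n => ∑ i ∈ Finset.range (n + 1), u ^ i * v ^ (n - i) with hS
  have hSle : ∀ n, ‖S n‖ ≤ (n + 1) * m ^ n :=
    norm_sum_pow_mul_pow_le (by linarith) hum hvm
  have hSv : ∀ n, S (n + 1) = v * S n + u ^ (n + 1) := fun n => by
    simp only [hS]
    rw [Finset.sum_range_succ, Nat.sub_self, pow_zero, mul_one, Finset.mul_sum]
    congr 1
    refine Finset.sum_congr rfl fun i hi => ?_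
    rw [Nat.succ_sub (Finset.mem_range_succ_iff.mp hi), pow_succ]
    ring
  have hrec : ∀ n, S (n + 2) = x * S (n + 1) - S n := fun n => by
    rw [hSv (n + 1), ← hadd]
    linear_combination (-u) * hSv n - S n * huv
  have hS0 : S 0 = 1 := by simp [hS]
  have hS1 : S 1 = x := by rw [hSv, hS0, ← hadd]; ring
  have key : ∀ n, (((chebX (n + 2) q).eval x : ℝ) : ℂ) = S (n + 2) - (q : ℂ)⁻¹ * S n := fun n => by
    induction n using Nat.strong_induction_on with
    | _ n ih =>
      match n with
      | 0 =>
        rw [chebX_two, chebX_one, hrec, hS0, hS1]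
        simp
        ring
      | 1 =>
        have h0 := ih 0 (by omega)
        rw [zero_add] at h0
        rw [chebX_add_three, hrec 1]
        simp only [Polynomial.eval_sub, Polynomial.eval_mul, Polynomial.eval_X, zero_add, chebX_one]
        push_cast
        rw [h0, hS0, hS1]
        ring
      | n + 2 =>
        have h0 := ih n (by omega)
        have h1 := ih (n + 1) (by omega)
        rw [chebX_add_three, hrec (n + 2)]
        simp only [Polynomial.eval_sub, Polynomial.eval_mul, Polynomial.eval_X]
        push_cast
        rw [h0, h1, hrec n]
        ring
  match r with
  | 0 => simp [chebX_zero]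
  | 1 =>
    have : m⁻¹ ≤ 1 := inv_le_one_of_one_le₀ hm
    rw [chebX_one, Polynomial.eval_X]
    push_cast
    linarith
  | n + 2 =>
    rw [← Real.norm_eq_abs, ← Complex.norm_real, key]
    refine (norm_sub_le _ _).trans ?_
    rw [norm_mul, norm_inv, Complex.norm_natCast]
    have h1 := hSle (n + 2)
    have h2 : (q : ℝ)⁻¹ * ‖S n‖ ≤ 1 * ((n + 1) * m ^ n) :=
      mul_le_mul (Nat.cast_inv_le_one q) (hSle n) (norm_nonneg _) zero_le_one
    have h3 : ((n : ℝ) + 1) * m ^ n ≤ (n + 3) * m ^ (n + 2) :=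
      mul_le_mul (by linarith) (pow_le_pow_right₀ hm (by omega)) (by positivity) (by positivity)
    push_cast at h1 ⊢
    linarith

theorem summable_succ_mul_geometric {c : ℝ} (h0 : 0 ≤ c) (h1 : c < 1) :
    Summable fun r : ℕ => ((r : ℝ) + 1) * c ^ r := by
  have h := summable_pow_mul_geometric_of_norm_lt_one 1 (by rwa [Real.norm_of_nonneg h0])
  have h' := summable_geometric_of_lt_one h0 h1
  refine (h.add h').congr fun r => ?_
  ring

/-- The generating function of the `X_{r,q}(x)`, written without division, so that no
non-vanishing of `1 - x t + t²` is presupposed. -/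
theorem chebX_generating_function (q : ℕ) {m x : ℝ} (hm : 1 ≤ m) (hx : |x| ≤ m + m⁻¹) {t : ℂ}
    (ht : ‖t‖ * m < 1) :
    Summable (fun r : ℕ => (((chebX r q).eval x : ℝ) : ℂ) * t ^ r) ∧
    (1 - x * t + t ^ 2) * ∑' r : ℕ, (((chebX r q).eval x : ℝ) : ℂ) * t ^ r =
      1 - (q : ℂ)⁻¹ * t ^ 2 := by
  set a : ℕ → ℂ := fun r => (((chebX r q).eval x : ℝ) : ℂ) * t ^ r with ha
  have hs : Summable a := by
    refine Summable.of_norm_bounded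
      ((summable_succ_mul_geometric (c := ‖t‖ * m) (by positivity) ht).mul_left 2) fun r => ?_
    rw [ha, norm_mul, norm_pow, Complex.norm_real, Real.norm_eq_abs, mul_pow]
    calc _ ≤ 2 * (r + 1) * m ^ r * ‖t‖ ^ r :=
          mul_le_mul_of_nonneg_right (abs_chebX_eval_le q hm hx r) (by positivity)
      _ = _ := by ring
  refine ⟨hs, ?_⟩
  have h1 := hs.sum_add_tsum_nat_add 1
  have h2 := hs.sum_add_tsum_nat_add 2
  have h3 := hs.sum_add_tsum_nat_add 3
  have hrec : ∑' n, a (n + 3) = x * t * ∑' n, a (n + 2) - t ^ 2 * ∑' n, a (n + 1) := by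
    rw [← tsum_mul_left, ← tsum_mul_left, ← Summable.tsum_sub
      (((summable_nat_add_iff 2).mpr hs).mul_left _) (((summable_nat_add_iff 1).mpr hs).mul_left _)]
    refine tsum_congr fun n => ?_
    simp only [ha, chebX_add_three, Polynomial.eval_sub, Polynomial.eval_mul, Polynomial.eval_X]
    push_cast
    ring
  have a0 : a 0 = 1 := by simp [ha, chebX_zero]
  have a1 : a 1 = x * t := by simp [ha, chebX_one]
  have a2 : a 2 = (x ^ 2 - 1 - (q : ℂ)⁻¹) * t ^ 2 := by
    simp only [ha, chebX_two, chebX_one, Polynomial.eval_sub, Polynomial.eval_mul,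
      Polynomial.eval_X, Polynomial.eval_C]
    push_cast
    ring
  simp only [Finset.sum_range_succ, Finset.sum_range_zero, a0, a1, a2] at h1 h2 h3
  linear_combination (-1 : ℂ) * h3 + hrec + x * t * h2 - t ^ 2 * h1

/-! ### Holomorphic functions on an ellipse -/

open Metric

theorem isOpen_ellipseInterior (ρ : ℝ) : IsOpen (ellipseInterior ρ) :=
  isOpen_lt (by fun_prop) continuous_const

theorem add_inv_lt_add_inv {r ρ : ℝ} (hr : 0 < r) (h1 : ρ⁻¹ < r) (h2 : r < ρ) :
    r + r⁻¹ < ρ + ρ⁻¹ := by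
  have hρ : 0 < ρ := hr.trans h2
  have e : ρ + ρ⁻¹ - (r + r⁻¹) = (ρ - r) * (r - ρ⁻¹) * r⁻¹ := by field_simp; ring
  have : 0 < (ρ - r) * (r - ρ⁻¹) * r⁻¹ :=
    mul_pos (mul_pos (by linarith) (by linarith)) (by positivity)
  linarith

/-- The map `t ↦ t + t⁻¹` sends the annulus `ρ⁻¹ < |t| < ρ` into the ellipse, and the circle of
radius `r` onto the ellipse with semi-axes `r + r⁻¹` and `|r - r⁻¹|`. -/
theorem add_inv_mem_ellipseInterior {ρ : ℝ} (hρ : 1 < ρ) {t : ℂ} (h1 : ρ⁻¹ < ‖t‖) (h2 : ‖t‖ < ρ) :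
    t + t⁻¹ ∈ ellipseInterior ρ := by
  have hr : 0 < ‖t‖ := lt_trans (by positivity) h1
  have hlt := add_inv_lt_add_inv hr h1 h2
  set r := ‖t‖
  have hn : t.re * t.re + t.im * t.im = r ^ 2 := by
    rw [← Complex.normSq_apply, Complex.normSq_eq_norm_sq]
  have hinv : t⁻¹ = (starRingEnd ℂ) t * ((r ^ 2)⁻¹ : ℝ) := by
    rw [Complex.inv_def, Complex.normSq_eq_norm_sq]
  have hre : (t + t⁻¹).re ^ 2 = (t.re ^ 2 / r ^ 2) * (r + r⁻¹) ^ 2 := by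
    rw [hinv, Complex.add_re, Complex.re_mul_ofReal, Complex.conj_re]; field_simp
  have him : (t + t⁻¹).im ^ 2 = (t.im ^ 2 / r ^ 2) * ((r + r⁻¹) ^ 2 - 4) := by
    rw [hinv, Complex.add_im, Complex.im_mul_ofReal, Complex.conj_im]; field_simp; ring
  have hB : (ρ - ρ⁻¹) ^ 2 = (ρ + ρ⁻¹) ^ 2 - 4 := by field_simp; ring
  have hBpos : 0 < (ρ - ρ⁻¹) ^ 2 := by
    have : ρ⁻¹ < 1 := inv_lt_one_of_one_lt₀ hρ
    exact pow_pos (by linarith) 2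
  have hsq : (r + r⁻¹) ^ 2 < (ρ + ρ⁻¹) ^ 2 := by gcongr
  have hc : t.re ^ 2 / r ^ 2 + t.im ^ 2 / r ^ 2 = 1 := by
    rw [← add_div, div_eq_one_iff_eq (by positivity)]; linarith
  have hx0 : 0 ≤ t.re ^ 2 / r ^ 2 := by positivity
  have hy0 : 0 ≤ t.im ^ 2 / r ^ 2 := by positivity
  change (t + t⁻¹).re ^ 2 / (ρ + ρ⁻¹) ^ 2 + (t + t⁻¹).im ^ 2 / (ρ - ρ⁻¹) ^ 2 < 1
  rw [hre, him, hB, mul_div_assoc, mul_div_assoc]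
  rw [hB] at hBpos
  have g1 : (r + r⁻¹) ^ 2 / (ρ + ρ⁻¹) ^ 2 < 1 := (div_lt_one (by linarith)).mpr hsq
  have g2 : ((r + r⁻¹) ^ 2 - 4) / ((ρ + ρ⁻¹) ^ 2 - 4) < 1 :=
    (div_lt_one hBpos).mpr (by linarith)
  generalize (r + r⁻¹) ^ 2 / (ρ + ρ⁻¹) ^ 2 = A at *
  generalize ((r + r⁻¹) ^ 2 - 4) / ((ρ + ρ⁻¹) ^ 2 - 4) = B at *
  generalize t.re ^ 2 / r ^ 2 = c at *
  generalize t.im ^ 2 / r ^ 2 = d at *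
  rcases hx0.eq_or_lt with h | h
  · nlinarith
  · nlinarith [mul_pos h (sub_pos.mpr g1), mul_nonneg hy0 (sub_pos.mpr g2).le]

theorem ofReal_mem_ellipseInterior {ρ m x : ℝ} (hm : 1 ≤ m) (hρ : m < ρ) (hx : |x| ≤ m + m⁻¹) :
    (x : ℂ) ∈ ellipseInterior ρ := by
  have h1 : ρ⁻¹ < 1 := inv_lt_one_of_one_lt₀ (by linarith)
  have hlt := hx.trans_lt (add_inv_lt_add_inv (by linarith) (by linarith) hρ)
  change (x : ℂ).re ^ 2 / (ρ + ρ⁻¹) ^ 2 + (x : ℂ).im ^ 2 / (ρ - ρ⁻¹) ^ 2 < 1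
  have h2 : 0 < ρ + ρ⁻¹ := (abs_nonneg x).trans_lt hlt
  rw [Complex.ofReal_re, Complex.ofReal_im, zero_pow two_ne_zero, zero_div, add_zero,
    div_lt_one (by positivity), ← sq_abs]
  gcongr

/-- The integral of the pullback of `F(w) dw` under `w = t + t⁻¹` vanishes: it may be taken over
the unit circle, where the integrand is odd under `t ↦ t⁻¹`. -/
theorem circleIntegral_comp_add_inv_eq_zero {ρ s : ℝ} (hs0 : 0 < s) (hs : ρ⁻¹ < s) (hs1 : s ≤ 1)
    (hρ : 1 < ρ) {F : ℂ → ℂ} (hF : DifferentiableOn ℂ F (ellipseInterior ρ)) :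
    ∮ t in C(0, s), F (t + t⁻¹) * (1 - (t⁻¹) ^ 2) = 0 := by
  have hd : ∀ t : ℂ, ρ⁻¹ < ‖t‖ → ‖t‖ < ρ →
      DifferentiableAt ℂ (fun t : ℂ => F (t + t⁻¹) * (1 - (t⁻¹) ^ 2)) t := fun t h1 h2 => by
    have ht : t ≠ 0 := norm_pos_iff.mp (lt_trans (by positivity) h1)
    have hFt := (hF.differentiableAt
      ((isOpen_ellipseInterior ρ).mem_nhds (add_inv_mem_ellipseInterior hρ h1 h2)))
    have hinv : DifferentiableAt ℂ (fun t : ℂ => t⁻¹) t := differentiableAt_inv ht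
    exact (hFt.comp t (differentiableAt_id.add hinv)).mul ((hinv.pow 2).const_sub 1)
  rw [← Complex.circleIntegral_eq_of_differentiable_on_annulus_off_countable (c := 0) (R := 1) hs0
    hs1 Set.countable_empty ?_ ?_]
  · simp only [circleIntegral, deriv_circleMap, smul_eq_mul]
    set g : ℝ → ℂ := fun θ => circleMap 0 1 θ * Complex.I *
      (F (circleMap 0 1 θ + (circleMap 0 1 θ)⁻¹) * (1 - ((circleMap 0 1 θ)⁻¹) ^ 2)) with hg
    have hodd : ∀ θ, g (2 * Real.pi - θ) = - g θ := fun θ => by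
      have hc : circleMap 0 1 (2 * Real.pi - θ) = (circleMap 0 1 θ)⁻¹ := by
        rw [circleMap_zero_inv, inv_one, ← (periodic_circleMap 0 1) (-θ)]
        congr 1; ring
      have hne : circleMap 0 1 θ ≠ 0 := circleMap_ne_center one_ne_zero
      simp only [hg, hc, inv_inv, add_comm (circleMap 0 1 θ)⁻¹]
      field_simp
      ring
    have h := intervalIntegral.integral_comp_sub_left (a := 0) (b := 2 * Real.pi) g (2 * Real.pi)
    -- The integral over a full period is its own negative.
    simp only [hodd, intervalIntegral.integral_neg, sub_self, sub_zero] at h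
    exact self_eq_neg.mp h.symm
  · intro t ht
    obtain ⟨h1, h2⟩ := ht
    rw [mem_closedBall_zero_iff] at h1
    rw [mem_ball_zero_iff, not_lt] at h2
    exact (hd t (by linarith) (by linarith)).continuousAt.continuousWithinAt
  · intro t ht
    obtain ⟨⟨h1, h2⟩, -⟩ := ht
    rw [mem_ball_zero_iff] at h1
    rw [mem_closedBall_zero_iff, not_le] at h2
    exact hd t (by linarith) (by linarith)

/-- The Cauchy integral formula over the boundary of an ellipse, parametrized by `w = t + t⁻¹`
with `t` on a circle of radius less than `1` (traversed so that `w` runs clockwise). -/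
theorem circleIntegral_cauchy_ellipse {ρ s : ℝ} (hs0 : 0 < s) (hs : ρ⁻¹ < s) (hs1 : s ≤ 1)
    (hρ : 1 < ρ) {h : ℂ → ℂ} (hh : DifferentiableOn ℂ h (ellipseInterior ρ)) {x : ℂ}
    (hx : x ∈ ellipseInterior ρ) (hne : ∀ t : ℂ, ‖t‖ ≤ s → 1 - x * t + t ^ 2 ≠ 0) :
    ∮ t in C(0, s), h (t + t⁻¹) * ((1 - t ^ 2) / (t * (1 - x * t + t ^ 2))) =
      2 * Real.pi * Complex.I * h x := by
  set F := dslope h x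
  have hF : DifferentiableOn ℂ F (ellipseInterior ρ) :=
    (Complex.differentiableOn_dslope ((isOpen_ellipseInterior ρ).mem_nhds hx)).mpr hh
  have hmem : ∀ t : ℂ, t ∈ sphere (0 : ℂ) s → t ≠ 0 ∧ t + t⁻¹ ∈ ellipseInterior ρ ∧
      1 - x * t + t ^ 2 ≠ 0 := fun t ht => by
    rw [mem_sphere_zero_iff_norm] at ht
    exact ⟨norm_pos_iff.mp (ht ▸ hs0), add_inv_mem_ellipseInterior hρ (by linarith) (by linarith),
      hne t ht.le⟩
  have hK : ∮ t in C(0, s), (1 - t ^ 2) / (t * (1 - x * t + t ^ 2)) =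
      2 * Real.pi * Complex.I := by
    have hd : DifferentiableOn ℂ (fun t : ℂ => (1 - t ^ 2) / (1 - x * t + t ^ 2))
        (closedBall 0 s) := by
      refine DifferentiableOn.div (by fun_prop) (by fun_prop) fun t ht => hne t ?_
      rwa [mem_closedBall_zero_iff] at ht
    have := hd.circleIntegral_sub_inv_smul (mem_ball_self hs0)
    simp only [sub_zero, smul_eq_mul] at this
    rw [show ((1 : ℂ) - 0 ^ 2) / (1 - x * 0 + 0 ^ 2) = 1 by simp, mul_one] at this
    rw [← this]
    refine circleIntegral.integral_congr hs0.le fun t _ => ?_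
    rw [mul_comm t, ← div_div, div_eq_inv_mul]
  have hcont : ContinuousOn (fun t : ℂ => t⁻¹) (sphere (0 : ℂ) s) :=
    continuousOn_id.inv₀ fun t ht => (hmem t ht).1
  have hcF : ContinuousOn (fun t : ℂ => F (t + t⁻¹) * (1 - (t⁻¹) ^ 2)) (sphere (0 : ℂ) s) :=
    (hF.continuousOn.comp (continuousOn_id.add hcont) fun t ht => (hmem t ht).2.1).mul
      (continuousOn_const.sub (hcont.pow 2))
  have hcK : ContinuousOn (fun t : ℂ => h x * ((1 - t ^ 2) / (t * (1 - x * t + t ^ 2))))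
      (sphere (0 : ℂ) s) := by
    refine continuousOn_const.mul (ContinuousOn.div (by fun_prop) (by fun_prop) fun t ht => ?_)
    exact mul_ne_zero (hmem t ht).1 (hmem t ht).2.2
  have hsplit : Set.EqOn (fun t : ℂ => h (t + t⁻¹) * ((1 - t ^ 2) / (t * (1 - x * t + t ^ 2))))
      (fun t => h x * ((1 - t ^ 2) / (t * (1 - x * t + t ^ 2))) - F (t + t⁻¹) * (1 - (t⁻¹) ^ 2))
      (sphere (0 : ℂ) s) := fun t ht => by
    obtain ⟨h0, -, h2⟩ := hmem t ht
    have e : t + t⁻¹ - x = (1 - x * t + t ^ 2) / t := by field_simp; ring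
    have hsl := sub_smul_dslope h x (t + t⁻¹)
    rw [smul_eq_mul, e] at hsl
    have e2 : h (t + t⁻¹) = h x + (1 - x * t + t ^ 2) / t * F (t + t⁻¹) := by
      rw [hsl]; ring
    simp only [e2]
    field_simp
    ring
  rw [circleIntegral.integral_congr hs0.le hsplit, circleIntegral.integral_sub
    (hcK.circleIntegrable hs0.le) (hcF.circleIntegrable hs0.le),
    circleIntegral_comp_add_inv_eq_zero hs0 hs hs1 hρ hF, circleIntegral.integral_const_mul, hK]
  ring

/-- A holomorphic function on an ellipse expands in the polynomials `X_{r,q}`, absolutely and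
uniformly on the interval `[-m - m⁻¹, m + m⁻¹]`, `m = √q`. The coefficients come from inserting
the generating function of the `X_{r,q}` into the Cauchy integral formula. -/
theorem exists_chebX_expansion {q : ℕ} (hq : 1 ≤ q) {ρ : ℝ} (hρ : √q < ρ) {h : ℂ → ℂ}
    (hh : DifferentiableOn ℂ h (ellipseInterior ρ)) :
    ∃ (b : ℕ → ℂ) (β : ℕ → ℝ), Summable β ∧ ∀ x : ℝ, |x| ≤ √q + (√q)⁻¹ →
      (∀ r, ‖b r * (((chebX r q).eval x : ℝ) : ℂ)‖ ≤ β r) ∧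
      HasSum (fun r => b r * (((chebX r q).eval x : ℝ) : ℂ)) (h x) := by
  have hm : 1 ≤ √(q : ℝ) := Real.one_le_sqrt.mpr (by exact_mod_cast hq)
  set m := √(q : ℝ)
  have hm0 : 0 < m := by linarith
  have hρ1 : 1 < ρ := by linarith
  obtain ⟨s, hs, hsm⟩ := exists_between (inv_strictAnti₀ hm0 hρ)
  have hs0 : 0 < s := lt_trans (by positivity) hs
  have hsm1 : s * m < 1 := by
    rwa [← one_div, lt_div_iff₀ hm0] at hsm
  have hs1 : s < 1 := hsm.trans_le (inv_le_one_of_one_le₀ hm)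
  have hq1 : ‖(q : ℂ)⁻¹‖ ≤ 1 := by
    rw [norm_inv, Complex.norm_natCast]; exact Nat.cast_inv_le_one q
  -- The numerator of the generating function vanishes only at `±√q`, outside the circle.
  have hnum : ∀ t : ℂ, ‖t‖ ≤ s → 1 - (q : ℂ)⁻¹ * t ^ 2 ≠ 0 := fun t ht h0 => by
    have h1 : (1 : ℂ) = (q : ℂ)⁻¹ * t ^ 2 := sub_eq_zero.mp h0
    have h2 : ‖(q : ℂ)⁻¹ * t ^ 2‖ < 1 := by
      rw [norm_mul, norm_pow]
      have : ‖t‖ ^ 2 < 1 := pow_lt_one₀ (norm_nonneg _) (ht.trans_lt hs1) two_ne_zero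
      nlinarith [norm_nonneg (q : ℂ)⁻¹, sq_nonneg ‖t‖]
    rw [← h1, norm_one] at h2
    exact lt_irrefl _ h2
  set g : ℂ → ℂ := fun t => h (t + t⁻¹) * ((1 - t ^ 2) / (t * (1 - (q : ℂ)⁻¹ * t ^ 2))) with hg
  have hsph : ∀ t ∈ sphere (0 : ℂ) s, t ≠ 0 ∧ t + t⁻¹ ∈ ellipseInterior ρ := fun t ht => by
    rw [mem_sphere_zero_iff_norm] at ht
    exact ⟨norm_pos_iff.mp (ht ▸ hs0), add_inv_mem_ellipseInterior hρ1 (by linarith) (by linarith)⟩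
  have hgc : ContinuousOn g (sphere (0 : ℂ) s) := by
    have hinv : ContinuousOn (fun t : ℂ => t⁻¹) (sphere (0 : ℂ) s) :=
      continuousOn_id.inv₀ fun t ht => (hsph t ht).1
    refine (hh.continuousOn.comp (continuousOn_id.add hinv) fun t ht => (hsph t ht).2).mul
      (ContinuousOn.div (by fun_prop) (by fun_prop) fun t ht => ?_)
    exact mul_ne_zero (hsph t ht).1 (hnum t (mem_sphere_zero_iff_norm.mp ht).le)
  obtain ⟨K, hK⟩ := (isCompact_sphere (0 : ℂ) s).exists_bound_of_continuousOn hgc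
  have hK0 : 0 ≤ K := (norm_nonneg _).trans (hK s (by simp [hs0.le]))
  have hb : ∀ r : ℕ, ‖(2 * Real.pi * Complex.I : ℂ)⁻¹ • ∮ t in C(0, s), g t * t ^ r‖ ≤
      s * (K * s ^ r) := fun r =>
    circleIntegral.norm_two_pi_i_inv_smul_integral_le_of_norm_le_const hs0.le fun t ht => by
      rw [norm_mul, norm_pow, mem_sphere_zero_iff_norm.mp ht]
      exact mul_le_mul_of_nonneg_right (hK t ht) (by positivity)
  have hsum : Summable fun r : ℕ => ((r : ℝ) + 1) * (s * m) ^ r :=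
    summable_succ_mul_geometric (by positivity) hsm1
  refine ⟨fun r => (2 * Real.pi * Complex.I : ℂ)⁻¹ • ∮ t in C(0, s), g t * t ^ r,
    fun r => 2 * s * K * (((r : ℝ) + 1) * (s * m) ^ r), hsum.mul_left _,
    fun x hx => ⟨fun r => ?_, ?_⟩⟩
  · rw [norm_mul, Complex.norm_real, Real.norm_eq_abs]
    refine (mul_le_mul (hb r) (abs_chebX_eval_le q hm hx r) (abs_nonneg _)
      (by positivity)).trans (le_of_eq ?_)
    simp only [mul_pow]
    ring
  have hgen : ∀ t : ℂ, ‖t‖ ≤ s → _ := fun t ht => chebX_generating_function q hm hx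
    (t := t) ((mul_le_mul_of_nonneg_right ht hm0.le).trans_lt hsm1)
  -- A zero of the denominator would be a zero of the numerator, as the power series converges.
  have hden : ∀ t : ℂ, ‖t‖ ≤ s → 1 - (x : ℂ) * t + t ^ 2 ≠ 0 := fun t ht h0 =>
    hnum t ht (by rw [← (hgen t ht).2, h0, zero_mul])
  have hcauchy := circleIntegral_cauchy_ellipse hs0 hs hs1.le hρ1 hh
    (ofReal_mem_ellipseInterior hm hρ hx) hden
  have hint : HasSum (fun r : ℕ => ∮ t in C(0, s),
      g t * ((((chebX r q).eval x : ℝ) : ℂ) * t ^ r))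
      (∮ t in C(0, s), h (t + t⁻¹) * ((1 - t ^ 2) / (t * (1 - x * t + t ^ 2)))) := by
    refine intervalIntegral.hasSum_integral_of_dominated_convergence
      (fun r _ => s * K * (2 * (((r : ℝ) + 1) * (s * m) ^ r))) (fun r => ?_) (fun r => ?_)
      (MeasureTheory.ae_of_all _ fun _ _ => (hsum.mul_left _).mul_left _) ?_ ?_
    · have hc : ContinuousOn (fun t => g t * ((((chebX r q).eval x : ℝ) : ℂ) * t ^ r))
          (sphere (0 : ℂ) s) := hgc.mul (by fun_prop)
      exact (intervalIntegrable_iff.mp (hc.circleIntegrable hs0.le).out).aestronglyMeasurable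
    · refine MeasureTheory.ae_of_all _ fun θ _ => ?_
      have hθ : circleMap 0 s θ ∈ sphere (0 : ℂ) s := circleMap_mem_sphere _ hs0.le _
      have hKθ := hK _ hθ
      beta_reduce
      generalize g (circleMap 0 s θ) = y at hKθ
      rw [deriv_circleMap, smul_eq_mul, norm_mul, norm_mul, norm_mul, norm_mul, norm_pow,
        Complex.norm_I, mul_one, mem_sphere_zero_iff_norm.mp hθ, Complex.norm_real,
        Real.norm_eq_abs, mul_assoc]
      refine mul_le_mul_of_nonneg_left (mul_le_mul hKθ ?_ (by positivity) hK0) hs0.le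
      refine (mul_le_mul_of_nonneg_right (abs_chebX_eval_le q hm hx r)
        (by positivity)).trans (le_of_eq ?_)
      rw [mul_pow]; ring
    · exact intervalIntegrable_const
    · refine MeasureTheory.ae_of_all _ fun θ _ => ?_
      have hθ : circleMap 0 s θ ∈ sphere (0 : ℂ) s := circleMap_mem_sphere _ hs0.le _
      have hle : ‖circleMap 0 s θ‖ ≤ s := (mem_sphere_zero_iff_norm.mp hθ).le
      obtain ⟨hs, ht⟩ := hgen _ hle
      have hne := (hsph _ hθ).1
      have hd := hden _ hle
      have hn := hnum _ hle
      generalize circleMap 0 s θ = t at *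
      refine HasSum.const_smul _ ?_
      have e : h (t + t⁻¹) * ((1 - t ^ 2) / (t * (1 - x * t + t ^ 2))) =
          g t * ∑' r : ℕ, (((chebX r q).eval x : ℝ) : ℂ) * t ^ r := by
        rw [eq_div_of_mul_eq hd ((mul_comm _ _).trans ht)]
        simp only [hg]
        generalize 1 - (q : ℂ)⁻¹ * t ^ 2 = N at hn
        field_simp
      change HasSum _ (h (t + t⁻¹) * ((1 - t ^ 2) / (t * (1 - x * t + t ^ 2))))
      rw [e]
      exact hs.hasSum.mul_left _
  rw [hcauchy] at hint
  have hpi : (2 * Real.pi * Complex.I : ℂ) ≠ 0 := Complex.two_pi_I_ne_zero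
  have := hint.mul_left (2 * Real.pi * Complex.I : ℂ)⁻¹
  rw [inv_mul_cancel_left₀ hpi] at this
  have e : (fun r => ((2 * Real.pi * Complex.I : ℂ)⁻¹ • ∮ t in C(0, s), g t * t ^ r) *
      (((chebX r q).eval x : ℝ) : ℂ)) = fun r => (2 * Real.pi * Complex.I : ℂ)⁻¹ *
      ∮ t in C(0, s), g t * ((((chebX r q).eval x : ℝ) : ℂ) * t ^ r) := by
    funext r
    simp only [mul_left_comm (g _), circleIntegral.integral_const_mul, smul_eq_mul]
    ring
  rw [e]
  exact this

/-! ### Integration of the expansion -/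

section Integration

open MeasureTheory

theorem integrable_mul_chebX {q : ℕ} (hq : 1 ≤ q) {ρ : ℝ} (hρ : √q < ρ) {h : ℂ → ℂ}
    (hh : DifferentiableOn ℂ h (ellipseInterior ρ)) {μ : Measure ℝ} [IsFiniteMeasure μ]
    (hμ : ∀ᵐ x ∂μ, |x| ≤ √q + (√q)⁻¹) (r : ℕ) :
    Integrable (fun x : ℝ => h x * (((chebX r q).eval x : ℝ) : ℂ)) μ := by
  have hm : 1 ≤ √(q : ℝ) := Real.one_le_sqrt.mpr (by exact_mod_cast hq)
  have hc : ContinuousOn (fun x : ℝ => h x * (((chebX r q).eval x : ℝ) : ℂ))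
      (Set.Icc (-(√q + (√q)⁻¹)) (√q + (√q)⁻¹)) := by
    refine ContinuousOn.mul (hh.continuousOn.comp (by fun_prop) fun x hx => ?_)
      (Continuous.continuousOn (by fun_prop))
    exact ofReal_mem_ellipseInterior hm hρ (abs_le.mpr hx)
  have := hc.integrableOn_Icc (μ := μ)
  rwa [IntegrableOn, Measure.restrict_eq_self_of_ae_mem] at this
  filter_upwards [hμ] with x hx using abs_le.mp hx

/-- Termwise integration of a uniformly convergent expansion in the `X_{r,q}`, against
`X_{s,q} dμ`. -/
theorem hasSum_integral_chebX {q : ℕ} (hq : 1 ≤ q) {μ : Measure ℝ} [IsFiniteMeasure μ]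
    (hμ : ∀ᵐ x ∂μ, |x| ≤ √q + (√q)⁻¹) {h : ℂ → ℂ} {b : ℕ → ℂ} {β : ℕ → ℝ} (hβ : Summable β)
    (hb : ∀ x : ℝ, |x| ≤ √q + (√q)⁻¹ → (∀ r, ‖b r * (((chebX r q).eval x : ℝ) : ℂ)‖ ≤ β r) ∧
      HasSum (fun r => b r * (((chebX r q).eval x : ℝ) : ℂ)) (h x)) (s : ℕ) :
    HasSum (fun r => b r * ((∫ x, (chebX r q).eval x * (chebX s q).eval x ∂μ : ℝ) : ℂ))
      (∫ x : ℝ, h x * (((chebX s q).eval x : ℝ) : ℂ) ∂μ) := by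
  have hm : 1 ≤ √(q : ℝ) := Real.one_le_sqrt.mpr (by exact_mod_cast hq)
  have key : HasSum (fun r => ∫ x : ℝ, b r * (((chebX r q).eval x : ℝ) : ℂ) *
      (((chebX s q).eval x : ℝ) : ℂ) ∂μ) (∫ x : ℝ, h x * (((chebX s q).eval x : ℝ) : ℂ) ∂μ) := by
    refine hasSum_integral_of_dominated_convergence
      (fun r _ => β r * (2 * (s + 1) * √q ^ s)) (fun r => ?_) (fun r => ?_)
      (MeasureTheory.ae_of_all _ fun _ => hβ.mul_right _) (integrable_const _) ?_
    · exact Continuous.aestronglyMeasurable (by fun_prop)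
    · filter_upwards [hμ] with x hx
      rw [norm_mul]
      have h1 := (hb x hx).1 r
      have h2 := abs_chebX_eval_le q hm hx s
      rw [← Real.norm_eq_abs, ← Complex.norm_real] at h2
      exact mul_le_mul h1 h2 (norm_nonneg _) ((norm_nonneg _).trans h1)
    · filter_upwards [hμ] with x hx using (hb x hx).2.mul_right _
  convert key using 1
  funext r
  simp only [mul_assoc]
  rw [integral_const_mul, ← integral_complex_ofReal]
  simp only [Complex.ofReal_mul]

end Integration

/-! ### The pre-trace formula -/

theorem theorem5p1 {V E : Type*} (q : ℕ) (hq : 1 ≤ q) (G : Multigraph V E)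
    (hG : G.IsRegular (q + 1)) (ρ : ℝ) (hρ : (q : ℝ) ^ (1 / 2 : ℝ) < ρ)
    (h : ℂ → ℂ) (hh : DifferentiableOn ℂ h (ellipseInterior ρ)) (v : V) :
    MeasureTheory.Integrable (fun x : ℝ => h (x : ℂ)) (G.vertexSpectralMeasure hG v) ∧
    MeasureTheory.Integrable (fun x : ℝ => h (x : ℂ)) (kestenMcKay q) ∧
    (∀ r : ℕ, 1 ≤ r →
      MeasureTheory.IntegrableOn
        (fun x : ℝ => h (x : ℂ) * (((chebX r q).eval x : ℝ) : ℂ)) (Set.Icc (-2) 2)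
        (kestenMcKay q)) ∧
    Summable (fun r : ℕ+ =>
      (((q : ℝ) ^ (-(r : ℝ) / 2) : ℝ) : ℂ) * chebCoeff r q h * (G.closedNBWalkCount r v : ℂ)) ∧
    ∫ x : ℝ, h (x : ℂ) ∂(G.vertexSpectralMeasure hG v) =
      ∫ x : ℝ, h (x : ℂ) ∂(kestenMcKay q) +
        ∑' r : ℕ+, (((q : ℝ) ^ (-(r : ℝ) / 2) : ℝ) : ℂ) * chebCoeff r q h *
          (G.closedNBWalkCount r v : ℂ) := by
  rw [← Real.sqrt_eq_rpow] at hρ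
  have hμ := G.ae_vertexSpectralMeasure_abs_le hq hG v
  have hν : ∀ᵐ x ∂(kestenMcKay q), |x| ≤ √q + (√q)⁻¹ :=
    (regularTree q).ae_vertexSpectralMeasure_abs_le hq (isRegular_regularTree q) ReducedWord.nil
  have := (Multigraph.isSpectralMeasure_vertexSpectralMeasure hG v).isProbabilityMeasure
  have := (isSpectralMeasure_kestenMcKay q).isProbabilityMeasure
  obtain ⟨b, β, hβ, hb⟩ := exists_chebX_expansion hq hρ hh
  have hIμ := integrable_mul_chebX hq hρ hh hμ
  have hIν := integrable_mul_chebX hq hρ hh hν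
  have hSμ := hasSum_integral_chebX hq hμ hβ hb 0
  have hSν := hasSum_integral_chebX hq hν hβ hb
  have hq0 : 1 + (q : ℂ)⁻¹ ≠ 0 := by
    have : (1 : ℝ) + (q : ℝ)⁻¹ ≠ 0 := by positivity
    simpa using Complex.ofReal_ne_zero.mpr this
  have hcoeff : ∀ n : ℕ, chebCoeff (n + 1) q h = b (n + 1) := fun n => by
    rw [chebCoeff, MeasureTheory.Measure.restrict_eq_self_of_ae_mem (ae_kestenMcKay_mem_Icc hq)]
    have h1 := hSν (n + 1)
    simp only [integral_chebX_mul_chebX_kestenMcKay hq] at h1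
    rw [← h1.tsum_eq, tsum_eq_single (n + 1) fun r hr => by simp [hr], if_pos rfl]
    push_cast
    rw [mul_left_comm, inv_mul_cancel₀ hq0, mul_one]
  have hmain : ∫ x : ℝ, h (x : ℂ) ∂(kestenMcKay q) = b 0 := by
    have h1 := hSν 0
    simp only [chebX_zero, Polynomial.eval_one, mul_one, Complex.ofReal_one] at h1
    rw [← h1.tsum_eq, tsum_eq_single 0 fun r hr => ?_]
    · simp [chebX_zero]
    · obtain ⟨n, rfl⟩ := Nat.exists_eq_succ_of_ne_zero hr
      rw [Nat.succ_eq_add_one, integral_chebX_kestenMcKay hq]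
      simp
  simp only [chebX_zero, Polynomial.eval_one, mul_one, Complex.ofReal_one] at hSμ
  have hterm : ∀ n : ℕ, b (n + 1) *
      ((∫ x, (chebX (n + 1) q).eval x ∂(G.vertexSpectralMeasure hG v) : ℝ) : ℂ) =
      (((q : ℝ) ^ (-((n + 1 : ℕ) : ℝ) / 2) : ℝ) : ℂ) * chebCoeff (n + 1) q h *
        (G.closedNBWalkCount (n + 1) v : ℂ) := fun n => by
    have hpow : (q : ℝ) ^ (-((n + 1 : ℕ) : ℝ) / 2) = ((q : ℝ) ^ (-(1 / 2) : ℝ)) ^ (n + 1) := by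
      rw [← Real.rpow_natCast, ← Real.rpow_mul (Nat.cast_nonneg _)]
      congr 1
      ring
    rw [G.integral_chebX_vertexSpectralMeasure hq, hcoeff, hpow]
    push_cast
    ring
  have hS := (hasSum_nat_add_iff' 1).mpr hSμ
  simp only [hterm] at hS
  rw [Finset.sum_range_one] at hS
  have hS' := (Equiv.pnatEquivNat.symm.hasSum_iff (f := fun r : ℕ+ =>
    (((q : ℝ) ^ (-(r : ℝ) / 2) : ℝ) : ℂ) * chebCoeff r q h *
      (G.closedNBWalkCount r v : ℂ))).mp hS
  refine ⟨by simpa [chebX_zero] using hIμ 0, by simpa [chebX_zero] using hIν 0,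
    fun r _ => (hIν r).integrableOn, hS'.summable, ?_⟩
  rw [hS'.tsum_eq, hmain]
  simp [chebX_zero]
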